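/- **Setting.** Let $\mathcal A\subseteq B(\mathcal H)$ and $\mathcal B\subseteq B(\mathcal G)$ be von Neumann algebras with $\mathbb Z_2$-gradings $\gamma_{\mathcal A},\gamma_{\mathcal B}$ (involutive $*$-automorphisms), and let $\mathcal B$ be in standard form on $\mathcal G$. Let $\mu,\nu$ be faithful normal states on $\mathcal A,\mathcal B$ that are even: $\mu\circ\gamma_{\mathcal A}=\mu$, $\nu\circ\gamma_{\mathcal B}=\nu$. Inner products are linear in the second variable. Let $\Lambda_\nu\in\mathcal G$ be the unique vector in the natural positive cone with $\nu(b)=\langle\Lambda_\nu,b\Lambda_\nu\rangle$ for $b\in\mathcal B$, and let $g$ be the unitary on $\mathcal G$ with $g\,b\Lambda_\nu=\gamma_{\mathcal B}(b)\Lambda_\nu$ for $b\in\mathcal B$. For an operator $h$ with $h^2=1$ put $h^{\pm1/2}=\tfrac12(1+h)\mp\tfrac i2(1-h)$. Let $\mathcal B'$ be the commutant of $\mathcal B$, $\mathcal B^\wr=g^{1/2}\mathcal B'g^{-1/2}$ the twisted commutant, and $\gamma_{\mathcal B}^{1/2}:\mathcal B'\to\mathcal B^\wr$, $b'\mapsto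 g^{1/2}b'g^{-1/2}$, the Klein isomorphism, with inverse $\gamma_{\mathcal B}^{-1/2}$. Put $\nu'=\langle\Lambda_\nu,\cdot\,\Lambda_\nu\rangle$ on $\mathcal B'$ and $\nu^\wr=\langle\Lambda_\nu,\cdot\,\Lambda_\nu\rangle$ on $\mathcal B^\wr$, and let $\gamma_{\mathcal B'}$, $\gamma_{\mathcal B^\wr}$ be the restrictions of $x\mapsto gxg$ to $\mathcal B'$ and $\mathcal B^\wr$. Let $\mathcal A\odot\mathcal B'$ be the algebraic tensor product, and let $\mathcal A\boxtimes\mathcal B^\wr$ be the algebraic Fermi tensor product: the same kind of vector space, with $(a\boxtimes b)(c\boxtimes d)=(-1)^{\partial b\,\partial c}\,ac\boxtimes bd$ and $(a\boxtimes b)^*=(-1)^{\partial a\,\partial b}\,a^*\boxtimes b^*$ for homogeneous $a,b,c,d$ of degrees $\partial a,\dots\in\{0,1\}$. A state on a unital $*$-algebra $\mathcal C$ is a linear functional $\omega$ with $\omega(1)=1$ and $\omega(c^*c)\ge0$ for all $c\in\mathcal C$. * $T^\gamma(\mu,\nu)$ is the set of states $\omega$ on $\mathcal A\odot\mathcal B'$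 with $\omega(a\odot1)=\mu(a)$, $\omega(1\odot b')=\nu'(b')$ and $\omega(\gamma_{\mathcal A}(a)\odot b')=\omega(a\odot\gamma_{\mathcal B'}(b'))$ for all $a\in\mathcal A$, $b'\in\mathcal B'$. * $T^{\mathrm F}(\mu,\nu)$ is the set of states $\omega$ on $\mathcal A\boxtimes\mathcal B^\wr$ with $\omega(a\boxtimes1)=\mu(a)$, $\omega(1\boxtimes b^\wr)=\nu^\wr(b^\wr)$ and $\omega(\gamma_{\mathcal A}(a)\boxtimes b^\wr)=\omega(a\boxtimes\gamma_{\mathcal B^\wr}(b^\wr))$ for all $a\in\mathcal A$, $b^\wr\in\mathcal B^\wr$. For $\omega$ in either set, on the corresponding algebra $\mathcal C$, let $\mathcal H_\omega^0=\mathcal C/\{c:\omega(c^*c)=0\}$ with $\langle[c],[d]\rangle=\omega(c^*d)$, $\Omega=[1]$, $\pi_\omega(c)[d]=[cd]$, and let $h_\omega$ be the linear operator on $\mathcal H_\omega^0$ with $h_\omega[a\odot b']=[\gamma_{\mathcal A}(a)\odot\gamma_{\mathcal B'}(b')]$, respectively $h_\omega[a\boxtimes b^\wr]=[\gamma_{\mathcal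 A}(a)\boxtimes\gamma_{\mathcal B^\wr}(b^\wr)]$. For $\omega\in T^\gamma(\mu,\nu)$ let $\omega_{\mathrm F}$ be the linear functional on $\mathcal A\boxtimes\mathcal B^\wr$ with $$\omega_{\mathrm F}(a\boxtimes b^\wr)=\big\langle\Omega,\ \pi_\omega(a\odot1)\,h_\omega^{1/2}\,\pi_\omega\big(1\odot\gamma_{\mathcal B}^{-1/2}(b^\wr)\big)\,h_\omega^{-1/2}\,\Omega\big\rangle .$$ For $\omega\in T^{\mathrm F}(\mu,\nu)$ let $\omega_\odot$ be the linear functional on $\mathcal A\odot\mathcal B'$ with $$\omega_\odot(a\odot b')=\big\langle\Omega,\ \pi_\omega(a\boxtimes1)\,h_\omega^{-1/2}\,\pi_\omega\big(1\boxtimes\gamma_{\mathcal B}^{1/2}(b')\big)\,h_\omega^{1/2}\,\Omega\big\rangle .$$ **Theorem 5.8.** The map $\omega\mapsto\omega_{\mathrm F}$ is a well-defined bijection $f:T^\gamma(\mu,\nu)\to T^{\mathrm F}(\mu,\nu)$, and its inverse is given by $f^{-1}(\omega)=\omega_\odot$ for all $\omega\in T^{\mathrm F}(\mu,\nu)$.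 -/

import Mathlib

open scoped TensorProduct ComplexOrder InnerProductSpace

set_option linter.unusedSectionVars false

namespace FermiTransport

noncomputable section

/-! ### Gradings of unital star-algebras -/

/-- A `ℤ/2`-grading of a complex unital star-algebra: an involutive star-automorphism. -/
structure Z2Grading (R : Type*) [Ring R] [Algebra ℂ R] [StarRing R] where
  toEquiv : R ≃⋆ₐ[ℂ] R
  involutive : ∀ a, toEquiv (toEquiv a) = a

namespace Z2Grading

section Basic

variable {R : Type*} [Ring R] [Algebra ℂ R] [StarRing R]

instance : CoeFun (Z2Grading R) (fun _ => R → R) := ⟨fun γ => γ.toEquiv⟩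

/-- The homogeneous components: `γ.part 0` is the even part `{a | γ a = a}` and `γ.part 1` is the
odd part `{a | γ a = -a}`. -/
def part (γ : Z2Grading R) (i : ZMod 2) : Submodule ℂ R where
  carrier := {a | γ a = (-1 : ℤˣ) ^ i • a}
  add_mem' {a b} ha hb := by
    simp only [Set.mem_ofPred_eq] at ha hb ⊢
    rw [map_add, ha, hb, smul_add]
  zero_mem' := by simp
  smul_mem' c a ha := by
    simp only [Set.mem_ofPred_eq] at ha ⊢
    rw [map_smul, ha, smul_comm]

theorem mem_part {γ : Z2Grading R} {i : ZMod 2} {a : R} :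
    a ∈ γ.part i ↔ γ a = (-1 : ℤˣ) ^ i • a := Iff.rfl

theorem mem_part_zero {γ : Z2Grading R} {a : R} : a ∈ γ.part 0 ↔ γ a = a := by
  rw [mem_part, uzpow_zero, one_smul]

theorem mem_part_one {γ : Z2Grading R} {a : R} : a ∈ γ.part 1 ↔ γ a = -a := by
  rw [mem_part, uzpow_one, Units.neg_smul, one_smul]

/-- The grading as a linear map. -/
def lin (γ : Z2Grading R) : R →ₗ[ℂ] R where
  toFun := γ
  map_add' := map_add γ.toEquiv
  map_smul' := map_smul γ.toEquiv

@[simp] theorem lin_apply (γ : Z2Grading R) (a : R) : γ.lin a = γ a := rfl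

/-- `a ↦ a₊ = (a + γ(a))/2`. -/
def even (γ : Z2Grading R) : R →ₗ[ℂ] R := (2⁻¹ : ℂ) • (LinearMap.id + γ.lin)

/-- `a ↦ a₋ = (a - γ(a))/2`. -/
def odd (γ : Z2Grading R) : R →ₗ[ℂ] R := (2⁻¹ : ℂ) • (LinearMap.id - γ.lin)

theorem even_apply (γ : Z2Grading R) (a : R) : γ.even a = (2⁻¹ : ℂ) • (a + γ a) := rfl

theorem odd_apply (γ : Z2Grading R) (a : R) : γ.odd a = (2⁻¹ : ℂ) • (a - γ a) := rfl

theorem even_mem (γ : Z2Grading R) (a : R) : γ.even a ∈ γ.part 0 := by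
  rw [mem_part_zero, even_apply, map_smul, map_add, γ.involutive, add_comm]

theorem odd_mem (γ : Z2Grading R) (a : R) : γ.odd a ∈ γ.part 1 := by
  rw [mem_part_one, odd_apply, map_smul, map_sub, γ.involutive, ← smul_neg, neg_sub]

theorem even_add_odd (γ : Z2Grading R) (a : R) : γ.even a + γ.odd a = a := by
  rw [even_apply, odd_apply, ← smul_add, add_add_sub_cancel, ← two_smul ℂ a, smul_smul]
  norm_num

theorem even_of_mem_zero {γ : Z2Grading R} {a : R} (h : a ∈ γ.part 0) : γ.even a = a := by
  rw [even_apply, mem_part_zero.1 h, ← two_smul ℂ a, smul_smul]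
  norm_num

theorem odd_of_mem_zero {γ : Z2Grading R} {a : R} (h : a ∈ γ.part 0) : γ.odd a = 0 := by
  rw [odd_apply, mem_part_zero.1 h, sub_self, smul_zero]

theorem even_of_mem_one {γ : Z2Grading R} {a : R} (h : a ∈ γ.part 1) : γ.even a = 0 := by
  rw [even_apply, mem_part_one.1 h, add_neg_cancel, smul_zero]

theorem odd_of_mem_one {γ : Z2Grading R} {a : R} (h : a ∈ γ.part 1) : γ.odd a = a := by
  rw [odd_apply, mem_part_one.1 h, sub_neg_eq_add, ← two_smul ℂ a, smul_smul]
  norm_num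

instance (γ : Z2Grading R) : SetLike.GradedMonoid γ.part where
  one_mem := by rw [mem_part_zero, map_one]
  mul_mem i j a b ha hb := by
    rw [mem_part] at ha hb ⊢
    rw [map_mul, ha, hb, uzpow_add, smul_mul_smul_comm]

/-- The decomposition `a = a₊ + a₋`, as a map into the direct sum of the components. -/
def decomposeLin (γ : Z2Grading R) : R →ₗ[ℂ] DirectSum (ZMod 2) (fun i => γ.part i) :=
  DirectSum.lof ℂ (ZMod 2) (fun i => γ.part i) 0 ∘ₗ γ.even.codRestrict (γ.part 0) γ.even_mem
    + DirectSum.lof ℂ (ZMod 2) (fun i => γ.part i) 1 ∘ₗ γ.odd.codRestrict (γ.part 1) γ.odd_mem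

instance (γ : Z2Grading R) : DirectSum.Decomposition γ.part :=
  DirectSum.Decomposition.ofLinearMap γ.part γ.decomposeLin
    (by ext a; simp [decomposeLin, even_add_odd])
    (by
      refine DirectSum.linearMap_ext ℂ fun i => ?_
      ext1 ⟨x, hx⟩
      have hi : ∀ i : ZMod 2, i = 0 ∨ i = 1 := by decide
      obtain rfl | rfl := hi i
      · have h1 : γ.even.codRestrict (γ.part 0) γ.even_mem x = ⟨x, hx⟩ :=
          Subtype.ext (even_of_mem_zero hx)
        have h2 : γ.odd.codRestrict (γ.part 1) γ.odd_mem x = 0 :=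
          Subtype.ext (odd_of_mem_zero hx)
        simp [decomposeLin, h1, h2]
      · have h1 : γ.even.codRestrict (γ.part 0) γ.even_mem x = 0 :=
          Subtype.ext (even_of_mem_one hx)
        have h2 : γ.odd.codRestrict (γ.part 1) γ.odd_mem x = ⟨x, hx⟩ :=
          Subtype.ext (odd_of_mem_one hx)
        simp [decomposeLin, h1, h2])

instance (γ : Z2Grading R) : GradedAlgebra γ.part where

theorem commutes_star (γ : Z2Grading R) (a : R) : γ (star a) = star (γ a) := map_star γ.toEquiv a

theorem map_even (γ : Z2Grading R) (a : R) : γ (γ.even a) = γ.even a :=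
  mem_part_zero.1 (γ.even_mem a)

theorem map_odd (γ : Z2Grading R) (a : R) : γ (γ.odd a) = -γ.odd a :=
  mem_part_one.1 (γ.odd_mem a)

/-- The grading of a star-subalgebra obtained by restricting an involutive star-automorphism. -/
def restrict (γ : Z2Grading R) [StarModule ℂ R] (S : StarSubalgebra ℂ R)
    (h : ∀ a ∈ S, γ a ∈ S) : Z2Grading S where
  toEquiv :=
    { toFun := fun a => ⟨γ a, h a a.2⟩
      invFun := fun a => ⟨γ a, h a a.2⟩
      left_inv := fun a => Subtype.ext (γ.involutive a)
      right_inv := fun a => Subtype.ext (γ.involutive a)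
      map_mul' := fun a b => Subtype.ext (map_mul γ.toEquiv (a : R) b)
      map_add' := fun a b => Subtype.ext (map_add γ.toEquiv (a : R) b)
      map_star' := fun a => Subtype.ext (map_star γ.toEquiv (a : R))
      map_smul' := fun c a => Subtype.ext (map_smul γ.toEquiv c (a : R)) }
  involutive := fun a => Subtype.ext (γ.involutive a)

@[simp] theorem restrict_coe (γ : Z2Grading R) [StarModule ℂ R] (S : StarSubalgebra ℂ R)
    (h : ∀ a ∈ S, γ a ∈ S) (a : S) : ((γ.restrict S h a : S) : R) = γ a := rfl

end Basic

end Z2Grading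

/-! ### The Fermi tensor product as a star-algebra -/

section Fermi

variable {R S : Type*} [Ring R] [Algebra ℂ R] [StarRing R] [StarModule ℂ R]
  [Ring S] [Algebra ℂ S] [StarRing S] [StarModule ℂ S]

/-- The algebraic Fermi (`ℤ/2`-graded) tensor product of two graded star-algebras, with product
`(a ⊠ b)(c ⊠ d) = (-1)^(∂b ∂c) ac ⊠ bd` for homogeneous `b`, `c`. -/
abbrev Fermi (γ : Z2Grading R) (δ : Z2Grading S) : Type _ := γ.part ᵍ⊗[ℂ] δ.part

namespace Fermi

variable (γ : Z2Grading R) (δ : Z2Grading S)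

/-- The elementary tensor `a ⊠ b` in the Fermi tensor product. -/
def tmul (a : R) (b : S) : Fermi γ δ := GradedTensorProduct.of ℂ γ.part δ.part (a ⊗ₜ[ℂ] b)

variable {γ δ}

@[elab_as_elim]
theorem induction {p : Fermi γ δ → Prop} (x : Fermi γ δ) (h0 : p 0)
    (ht : ∀ a b, p (tmul γ δ a b)) (ha : ∀ x y, p x → p y → p (x + y)) : p x :=
  TensorProduct.induction_on (motive := fun z => p (GradedTensorProduct.of ℂ γ.part δ.part z))
    ((GradedTensorProduct.of ℂ γ.part δ.part).symm x) (by simpa using h0) ht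
    (fun x y hx hy => by rw [map_add]; exact ha _ _ hx hy)

theorem tmul_add (a : R) (b c : S) : tmul γ δ a (b + c) = tmul γ δ a b + tmul γ δ a c := by
  rw [tmul, TensorProduct.tmul_add, map_add]; rfl

theorem add_tmul (a c : R) (b : S) : tmul γ δ (a + c) b = tmul γ δ a b + tmul γ δ c b := by
  rw [tmul, TensorProduct.add_tmul, map_add]; rfl

theorem tmul_neg (a : R) (b : S) : tmul γ δ a (-b) = -tmul γ δ a b := by
  rw [tmul, TensorProduct.tmul_neg, map_neg]; rfl

theorem neg_tmul (a : R) (b : S) : tmul γ δ (-a) b = -tmul γ δ a b := by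
  rw [tmul, TensorProduct.neg_tmul, map_neg]; rfl

theorem tmul_zero (a : R) : tmul γ δ a 0 = 0 := by
  rw [tmul, TensorProduct.tmul_zero, map_zero]

theorem zero_tmul (b : S) : tmul γ δ 0 b = 0 := by
  rw [tmul, TensorProduct.zero_tmul, map_zero]

theorem tmul_mul_tmul_of_mem {i j : ZMod 2} (a c : R) (b d : S) (hb : b ∈ δ.part i)
    (hc : c ∈ γ.part j) :
    tmul γ δ a b * tmul γ δ c d = (-1 : ℤˣ) ^ (i * j) • tmul γ δ (a * c) (b * d) :=
  GradedTensorProduct.tmul_coe_mul_coe_tmul γ.part δ.part a ⟨b, hb⟩ ⟨c, hc⟩ d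

theorem tmul_mul_tmul_even_left (a c : R) (b d : S) :
    tmul γ δ a (δ.even b) * tmul γ δ c d = tmul γ δ (a * c) (δ.even b * d) := by
  have h := tmul_mul_tmul_of_mem a (γ.even c) _ d (δ.even_mem b) (γ.even_mem c)
  have h' := tmul_mul_tmul_of_mem a (γ.odd c) _ d (δ.even_mem b) (γ.odd_mem c)
  rw [zero_mul, uzpow_zero, one_smul] at h h'
  rw [← γ.even_add_odd c, add_tmul, mul_add, h, h', mul_add, add_tmul]

theorem tmul_mul_tmul_odd_left (a c : R) (b d : S) :
    tmul γ δ a (δ.odd b) * tmul γ δ c d = tmul γ δ (a * γ c) (δ.odd b * d) := by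
  have h := tmul_mul_tmul_of_mem a (γ.even c) _ d (δ.odd_mem b) (γ.even_mem c)
  have h' := tmul_mul_tmul_of_mem a (γ.odd c) _ d (δ.odd_mem b) (γ.odd_mem c)
  rw [mul_zero, uzpow_zero, one_smul] at h
  rw [mul_one, uzpow_one, Units.neg_smul, one_smul] at h'
  have hc : γ c = γ.even c - γ.odd c := by
    conv_lhs => rw [← γ.even_add_odd c]
    rw [map_add, γ.map_even, γ.map_odd, sub_eq_add_neg]
  rw [hc]
  nth_rewrite 1 [← γ.even_add_odd c]
  rw [add_tmul, mul_add, h, h', mul_sub, sub_eq_add_neg, add_tmul, neg_tmul]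

/-- `(a ⊠ b)(c ⊠ d) = ac ⊠ b₊d + aγ(c) ⊠ b₋d`. -/
theorem tmul_mul_tmul (a c : R) (b d : S) :
    tmul γ δ a b * tmul γ δ c d
      = tmul γ δ (a * c) (δ.even b * d) + tmul γ δ (a * γ c) (δ.odd b * d) := by
  rw [← tmul_mul_tmul_even_left, ← tmul_mul_tmul_odd_left, ← add_mul, ← tmul_add,
    δ.even_add_odd]

theorem one_def : (1 : Fermi γ δ) = tmul γ δ 1 1 := rfl

/-- The sign operator `a ⊗ b ↦ (-1)^(∂a ∂b) a ⊗ b`, that is, `a ⊗ b ↦ a ⊗ b₊ + γ(a) ⊗ b₋`. -/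
def signTwist (γ : Z2Grading R) (δ : Z2Grading S) : R ⊗[ℂ] S →ₗ[ℂ] R ⊗[ℂ] S :=
  TensorProduct.map LinearMap.id δ.even + TensorProduct.map γ.lin δ.odd

/-- The involution of the Fermi tensor product: `(a ⊠ b)* = (-1)^(∂a ∂b) a* ⊠ b*` for
homogeneous `a`, `b`. -/
instance : Star (Fermi γ δ) where
  star x := GradedTensorProduct.of ℂ γ.part δ.part
    (star (signTwist γ δ ((GradedTensorProduct.of ℂ γ.part δ.part).symm x)))

/-- `(a ⊠ b)* = a* ⊠ (b₊)* + γ(a)* ⊠ (b₋)*`. -/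
theorem star_tmul (a : R) (b : S) :
    star (tmul γ δ a b)
      = tmul γ δ (star a) (star (δ.even b)) + tmul γ δ (star (γ a)) (star (δ.odd b)) := by
  change GradedTensorProduct.of ℂ γ.part δ.part (star (signTwist γ δ (a ⊗ₜ[ℂ] b))) = _
  simp [signTwist, tmul, star_add]

theorem star_add' (x y : Fermi γ δ) : star (x + y) = star x + star y := by
  change GradedTensorProduct.of ℂ γ.part δ.part (star (signTwist γ δ _)) = _
  rw [map_add, map_add, star_add, map_add]
  rfl

theorem star_mem_part {γ : Z2Grading R} {i : ZMod 2} {a : R} (h : a ∈ γ.part i) :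
    star a ∈ γ.part i := by
  rw [Z2Grading.mem_part] at h ⊢
  rw [γ.commutes_star, h, Units.smul_def, star_zsmul, ← Units.smul_def]

theorem star_tmul_of_mem {i j : ZMod 2} {a : R} {b : S} (ha : a ∈ γ.part i) (hb : b ∈ δ.part j) :
    star (tmul γ δ a b) = (-1 : ℤˣ) ^ (i * j) • tmul γ δ (star a) (star b) := by
  have hi : ∀ i : ZMod 2, i = 0 ∨ i = 1 := by decide
  rw [star_tmul, Z2Grading.mem_part.1 ha]
  obtain rfl | rfl := hi j
  · rw [Z2Grading.even_of_mem_zero hb, Z2Grading.odd_of_mem_zero hb, star_zero, tmul_zero,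
      add_zero, mul_zero, uzpow_zero, one_smul]
  · rw [Z2Grading.even_of_mem_one hb, Z2Grading.odd_of_mem_one hb, star_zero, tmul_zero, zero_add,
      mul_one]
    obtain rfl | rfl := hi i
    · simp
    · simp [Units.neg_smul, neg_tmul]

/-- Elements of the Fermi tensor product are sums of tensors of homogeneous elements. -/
theorem induction_homogeneous {p : Fermi γ δ → Prop} (x : Fermi γ δ) (h0 : p 0)
    (ht : ∀ i j a b, a ∈ γ.part i → b ∈ δ.part j → p (tmul γ δ a b))
    (ha : ∀ x y, p x → p y → p (x + y)) : p x := by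
  induction x using induction with
  | h0 => exact h0
  | ht a b =>
    rw [← γ.even_add_odd a, ← δ.even_add_odd b, tmul_add, add_tmul, add_tmul]
    exact ha _ _ (ha _ _ (ht _ _ _ _ (γ.even_mem a) (δ.even_mem b))
      (ht _ _ _ _ (γ.odd_mem a) (δ.even_mem b))) (ha _ _ (ht _ _ _ _ (γ.even_mem a) (δ.odd_mem b))
      (ht _ _ _ _ (γ.odd_mem a) (δ.odd_mem b)))
  | ha x y hx hy => exact ha _ _ hx hy

theorem star_units_smul (u : ℤˣ) (x : Fermi γ δ) : star (u • x) = u • star x := by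
  have h0 : star (0 : Fermi γ δ) = 0 := by
    have h := star_add' (0 : Fermi γ δ) 0
    rwa [add_zero, left_eq_add] at h
  have hneg : star (-x) = -star x := by
    rw [eq_neg_iff_add_eq_zero, ← star_add', neg_add_cancel, h0]
  obtain rfl | rfl := Int.units_eq_one_or u
  · simp
  · rw [Units.neg_smul, one_smul, hneg, Units.neg_smul, one_smul]

instance : StarRing (Fermi γ δ) where
  star_involutive x := by
    induction x using induction_homogeneous with
    | h0 =>
      have h0 : star (0 : Fermi γ δ) = 0 := by
        have h := star_add' (0 : Fermi γ δ) 0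
        rwa [add_zero, left_eq_add] at h
      rw [h0, h0]
    | ht i j a b ha hb =>
      rw [star_tmul_of_mem ha hb, star_units_smul, star_tmul_of_mem (star_mem_part ha)
        (star_mem_part hb), smul_smul, Int.units_mul_self, one_smul, star_star, star_star]
    | ha x y hx hy => rw [star_add', star_add', hx, hy]
  star_mul x y := by
    have h0 : star (0 : Fermi γ δ) = 0 := by
      have h := star_add' (0 : Fermi γ δ) 0
      rwa [add_zero, left_eq_add] at h
    induction x using induction_homogeneous with
    | h0 => rw [zero_mul, h0, mul_zero]
    | ha x x' hx hx' => rw [add_mul, star_add', star_add', hx, hx', mul_add]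
    | ht i j a b ha hb =>
      induction y using induction_homogeneous with
      | h0 => rw [mul_zero, h0, zero_mul]
      | ha y y' hy hy' => rw [mul_add, star_add', star_add', hy, hy', add_mul]
      | ht k l c d hc hd =>
        rw [tmul_mul_tmul_of_mem a c b d hb hc, star_units_smul,
          star_tmul_of_mem (SetLike.mul_mem_graded ha hc) (SetLike.mul_mem_graded hb hd),
          star_tmul_of_mem ha hb, star_tmul_of_mem hc hd, smul_mul_smul_comm,
          tmul_mul_tmul_of_mem _ _ _ _ (star_mem_part hd) (star_mem_part ha), smul_smul, smul_smul,
          star_mul, star_mul, ← uzpow_add, ← uzpow_add, ← uzpow_add]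
        congr 2
        have h2 : (2 : ZMod 2) = 0 := rfl
        linear_combination (j * k : ZMod 2) * h2
  star_add := star_add'

instance : StarModule ℂ (Fermi γ δ) where
  star_smul c x := by
    change GradedTensorProduct.of ℂ γ.part δ.part (star (signTwist γ δ _)) = _
    rw [map_smul, map_smul, star_smul, map_smul]
    rfl

end Fermi

/-! ### Product gradings -/

namespace Z2Grading

/-- The grading `γ ⊙ δ` of the usual algebraic tensor product. -/
def tensor (γ : Z2Grading R) (δ : Z2Grading S) : Z2Grading (R ⊗[ℂ] S) where
  toEquiv :=
    { toFun := TensorProduct.map γ.lin δ.lin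
      invFun := TensorProduct.map γ.lin δ.lin
      left_inv := fun x => by
        induction x with
        | zero => simp
        | tmul a b => simp [γ.involutive, δ.involutive]
        | add x y hx hy => rw [map_add, map_add, hx, hy]
      right_inv := fun x => by
        induction x with
        | zero => simp
        | tmul a b => simp [γ.involutive, δ.involutive]
        | add x y hx hy => rw [map_add, map_add, hx, hy]
      map_mul' := fun x y => by
        induction x with
        | zero => simp
        | add x x' hx hx' => rw [add_mul, map_add, map_add, hx, hx', add_mul]
        | tmul a b =>
          induction y with
          | zero => simp
          | add y y' hy hy' => rw [mul_add, map_add, map_add, hy, hy', mul_add]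
          | tmul c d => simp
      map_add' := map_add _
      map_star' := fun x => by
        induction x with
        | zero => simp
        | tmul a b => simp [commutes_star]
        | add x y hx hy => rw [star_add, map_add, map_add, star_add, hx, hy]
      map_smul' := map_smul _ }
  involutive := fun x => by
    change TensorProduct.map γ.lin δ.lin (TensorProduct.map γ.lin δ.lin x) = x
    induction x with
    | zero => simp
    | tmul a b => simp [γ.involutive, δ.involutive]
    | add x y hx hy => rw [map_add, map_add, hx, hy]

theorem tensor_tmul (γ : Z2Grading R) (δ : Z2Grading S) (a : R) (b : S) :
    γ.tensor δ (a ⊗ₜ[ℂ] b) = γ a ⊗ₜ[ℂ] δ b := rfl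

/-- The linear map `γ ⊠ δ` on the Fermi tensor product. -/
def fermiLin (γ : Z2Grading R) (δ : Z2Grading S) : Fermi γ δ →ₗ[ℂ] Fermi γ δ :=
  (GradedTensorProduct.of ℂ γ.part δ.part).toLinearMap ∘ₗ TensorProduct.map γ.lin δ.lin
    ∘ₗ (GradedTensorProduct.of ℂ γ.part δ.part).symm.toLinearMap

theorem fermiLin_tmul (γ : Z2Grading R) (δ : Z2Grading S) (a : R) (b : S) :
    γ.fermiLin δ (Fermi.tmul γ δ a b) = Fermi.tmul γ δ (γ a) (δ b) := rfl

theorem fermiLin_fermiLin (γ : Z2Grading R) (δ : Z2Grading S) (x : Fermi γ δ) :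
    γ.fermiLin δ (γ.fermiLin δ x) = x := by
  induction x using Fermi.induction with
  | h0 => simp
  | ht a b => rw [fermiLin_tmul, fermiLin_tmul, γ.involutive, δ.involutive]
  | ha x y hx hy => rw [map_add, map_add, hx, hy]

theorem commutes_even (γ : Z2Grading R) (a : R) : γ (γ.even a) = γ.even (γ a) := by
  simp only [even_apply, map_smul, map_add]

theorem commutes_odd (γ : Z2Grading R) (a : R) : γ (γ.odd a) = γ.odd (γ a) := by
  simp only [odd_apply, map_smul, map_sub]

/-- The grading `γ ⊠ δ` of the Fermi tensor product. -/
def fermi (γ : Z2Grading R) (δ : Z2Grading S) : Z2Grading (Fermi γ δ) where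
  toEquiv :=
    { toFun := γ.fermiLin δ
      invFun := γ.fermiLin δ
      left_inv := fermiLin_fermiLin γ δ
      right_inv := fermiLin_fermiLin γ δ
      map_mul' := fun x y => by
        induction x using Fermi.induction with
        | h0 => simp
        | ha x x' hx hx' => rw [add_mul, map_add, map_add, hx, hx', add_mul]
        | ht a b =>
          induction y using Fermi.induction with
          | h0 => simp
          | ha y y' hy hy' => rw [mul_add, map_add, map_add, hy, hy', mul_add]
          | ht c d =>
            rw [Fermi.tmul_mul_tmul, map_add, fermiLin_tmul, fermiLin_tmul, fermiLin_tmul,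
              fermiLin_tmul, Fermi.tmul_mul_tmul, map_mul, map_mul, map_mul, map_mul,
              commutes_even, commutes_odd]
      map_add' := map_add _
      map_star' := fun x => by
        induction x using Fermi.induction with
        | h0 => rw [star_zero, map_zero, star_zero]
        | ht a b =>
          rw [Fermi.star_tmul, map_add, fermiLin_tmul, fermiLin_tmul, fermiLin_tmul,
            Fermi.star_tmul, commutes_star, commutes_star, commutes_star, commutes_star,
              commutes_even, commutes_odd]
        | ha x y hx hy => rw [star_add, map_add, map_add, star_add, hx, hy]
      map_smul' := map_smul _ }
  involutive := fermiLin_fermiLin γ δ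

theorem fermi_tmul (γ : Z2Grading R) (δ : Z2Grading S) (a : R) (b : S) :
    γ.fermi δ (Fermi.tmul γ δ a b) = Fermi.tmul γ δ (γ a) (δ b) := rfl

end Z2Grading

end Fermi

/-! ### States on unital star-algebras and their cyclic representations -/

/-- A state on a complex unital star-algebra `C`: a linear functional `ω` with `ω 1 = 1` and
`ω (c* c) ≥ 0` for all `c`. -/
structure AlgState (C : Type*) [Ring C] [Algebra ℂ C] [StarRing C] where
  toLin : C →ₗ[ℂ] ℂ
  map_one : toLin 1 = 1
  nonneg : ∀ c, 0 ≤ toLin (star c * c)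

namespace AlgState

variable {C : Type*} [Ring C] [Algebra ℂ C] [StarRing C]

instance : CoeFun (AlgState C) (fun _ => C → ℂ) := ⟨fun ω => ω.toLin⟩

variable [StarModule ℂ C]

theorem conj_star_mul (ω : AlgState C) (x y : C) :
    starRingEnd ℂ (ω (star y * x)) = ω (star x * y) := by
  have key : ∀ c, (ω (star c * c)).im = 0 := fun c => (Complex.nonneg_iff.1 (ω.nonneg c)).2.symm
  have h1 := key (x + y)
  have h2 := key (x + Complex.I • y)
  have hx := key x
  have hy := key y
  simp only [star_add, star_smul, add_mul, mul_add, map_add, smul_mul_assoc, mul_smul_comm,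
    map_smul, Complex.add_im, smul_eq_mul, Complex.mul_im, Complex.mul_re, Complex.I_re,
    Complex.I_im, RCLike.star_def, Complex.conj_I, Complex.neg_re, Complex.neg_im] at h1 h2
  apply Complex.ext
  · rw [Complex.conj_re]; linarith
  · rw [Complex.conj_im]; linarith

/-- The positive semidefinite sesquilinear form `(c, d) ↦ ω (c* d)`. -/
@[reducible]
def preCore (ω : AlgState C) : PreInnerProductSpace.Core ℂ C where
  inner c d := ω (star c * d)
  conj_inner_symm x y := ω.conj_star_mul x y
  re_inner_nonneg x := (Complex.nonneg_iff.1 (ω.nonneg x)).1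
  add_left x y z := by rw [star_add, add_mul, map_add]
  smul_left x y r := by rw [star_smul, smul_mul_assoc, map_smul]; rfl

theorem null_right (ω : AlgState C) {c : C} (hc : ω (star c * c) = 0) (d : C) :
    ω (star d * c) = 0 := by
  have h := @InnerProductSpace.Core.inner_mul_inner_self_le ℂ C _ _ _ ω.preCore c d
  change ‖ω (star c * d)‖ * ‖ω (star d * c)‖ ≤
    (ω (star c * c)).re * (ω (star d * d)).re at h
  rw [hc, Complex.zero_re, zero_mul, ← ω.conj_star_mul, RCLike.norm_conj] at h
  have h2 := mul_self_eq_zero.1 (le_antisymm h (mul_self_nonneg _))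
  exact norm_eq_zero.1 h2

theorem null_left (ω : AlgState C) {c : C} (hc : ω (star c * c) = 0) (d : C) :
    ω (star c * d) = 0 := by
  rw [← ω.conj_star_mul, ω.null_right hc, map_zero]

/-- The left ideal `I_ω = {c | ω (c* c) = 0}`, as a linear subspace. -/
def nullSpace (ω : AlgState C) : Submodule ℂ C where
  carrier := {c | ω (star c * c) = 0}
  zero_mem' := by simp
  add_mem' {a b} ha hb := by
    simp only [Set.mem_ofPred_eq] at ha hb ⊢
    rw [star_add, add_mul, mul_add, mul_add, map_add, map_add, map_add, ha, hb,
      ω.null_right hb, ω.null_right ha]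
    simp
  smul_mem' r a ha := by
    simp only [Set.mem_ofPred_eq] at ha ⊢
    rw [star_smul, smul_mul_smul_comm, map_smul, ha, smul_zero]

theorem mem_nullSpace (ω : AlgState C) {c : C} : c ∈ ω.nullSpace ↔ ω (star c * c) = 0 := Iff.rfl

theorem mul_mem_nullSpace (ω : AlgState C) (c : C) {d : C} (hd : d ∈ ω.nullSpace) :
    c * d ∈ ω.nullSpace := by
  rw [mem_nullSpace] at hd ⊢
  rw [star_mul, mul_assoc]
  have h := ω.null_left hd (star c * (c * d))
  exact h

/-- The pre-Hilbert space `H_ω⁰ = C / I_ω` of the cyclic representation of a state `ω`. -/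
def GNS (ω : AlgState C) : Type _ := C ⧸ ω.nullSpace

instance (ω : AlgState C) : AddCommGroup ω.GNS := inferInstanceAs (AddCommGroup (C ⧸ ω.nullSpace))

instance (ω : AlgState C) : Module ℂ ω.GNS := inferInstanceAs (Module ℂ (C ⧸ ω.nullSpace))

/-- The class map `c ↦ [c]`. -/
def toGNS (ω : AlgState C) : C →ₗ[ℂ] ω.GNS := ω.nullSpace.mkQ

theorem toGNS_surjective (ω : AlgState C) : Function.Surjective ω.toGNS :=
  ω.nullSpace.mkQ_surjective

theorem toGNS_eq_zero (ω : AlgState C) {c : C} : ω.toGNS c = 0 ↔ ω (star c * c) = 0 :=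
  Submodule.Quotient.mk_eq_zero ω.nullSpace

/-- The sesquilinear form `(c, d) ↦ ω (c* d)`. -/
def form (ω : AlgState C) : C →ₗ⋆[ℂ] C →ₗ[ℂ] ℂ :=
  LinearMap.mk₂'ₛₗ (starRingEnd ℂ) (RingHom.id ℂ) (fun c d => ω (star c * d))
    (fun a b d => by rw [star_add, add_mul, map_add])
    (fun r a d => by rw [star_smul, smul_mul_assoc, map_smul]; rfl)
    (fun c a b => by rw [mul_add, map_add])
    (fun r c d => by rw [mul_smul_comm, map_smul]; rfl)

/-- The form induced on `H_ω⁰` by `(c, d) ↦ ω (c* d)`. -/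
def gnsForm (ω : AlgState C) : ω.GNS →ₗ⋆[ℂ] ω.GNS →ₗ[ℂ] ℂ :=
  LinearMap.flip (ω.nullSpace.liftQ
    (LinearMap.flip (ω.nullSpace.liftQ ω.form (fun c hc => by
      ext d
      exact ω.null_left hc d)))
    (fun d hd => by
      rw [LinearMap.mem_ker]
      ext x
      obtain ⟨c, rfl⟩ := ω.nullSpace.mkQ_surjective x
      exact ω.null_right hd c))

/-- The inner product of `H_ω⁰`. -/
instance (ω : AlgState C) : Inner ℂ ω.GNS := ⟨fun x y => ω.gnsForm x y⟩

/-- `⟨[c], [d]⟩ = ω (c* d)`. -/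
theorem inner_toGNS (ω : AlgState C) (c d : C) :
    inner ℂ (ω.toGNS c) (ω.toGNS d) = ω (star c * d) := rfl

/-- `H_ω⁰` is an inner product space. -/
@[reducible]
def gnsCore (ω : AlgState C) : InnerProductSpace.Core ℂ ω.GNS where
  conj_inner_symm x y := by
    obtain ⟨c, rfl⟩ := ω.toGNS_surjective x
    obtain ⟨d, rfl⟩ := ω.toGNS_surjective y
    exact ω.conj_star_mul c d
  re_inner_nonneg x := by
    obtain ⟨c, rfl⟩ := ω.toGNS_surjective x
    exact (Complex.nonneg_iff.1 (ω.nonneg c)).1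
  add_left x y z := by
    change ω.gnsForm (x + y) z = _
    rw [map_add]; rfl
  smul_left x y r := by
    change ω.gnsForm (r • x) y = _
    rw [LinearMap.map_smulₛₗ]; rfl
  definite x hx := by
    obtain ⟨c, rfl⟩ := ω.toGNS_surjective x
    exact ω.toGNS_eq_zero.2 hx

instance (ω : AlgState C) : NormedAddCommGroup ω.GNS :=
  @InnerProductSpace.Core.toNormedAddCommGroup ℂ ω.GNS _ _ _ ω.gnsCore

instance (ω : AlgState C) : InnerProductSpace ℂ ω.GNS := InnerProductSpace.ofCore ω.gnsCore.toCore

/-- The cyclic vector `Ω = [1]`. -/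
def cyclicVector (ω : AlgState C) : ω.GNS := ω.toGNS 1

/-- The representation `π_ω⁰ : C → L(H_ω⁰)`, `π_ω⁰(c)[d] = [cd]`. -/
def rep (ω : AlgState C) : C →ₐ[ℂ] Module.End ℂ ω.GNS :=
  AlgHom.ofLinearMap
    { toFun := fun c => ω.nullSpace.mapQ ω.nullSpace (LinearMap.mulLeft ℂ c)
        (fun _ hd => ω.mul_mem_nullSpace c hd)
      map_add' := fun a b => by
        refine LinearMap.ext fun x => ?_
        obtain ⟨d, rfl⟩ := ω.toGNS_surjective x
        change ω.toGNS ((a + b) * d) = ω.toGNS (a * d) + ω.toGNS (b * d)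
        rw [add_mul, map_add]
      map_smul' := fun r a => by
        refine LinearMap.ext fun x => ?_
        obtain ⟨d, rfl⟩ := ω.toGNS_surjective x
        change ω.toGNS ((r • a) * d) = r • ω.toGNS (a * d)
        rw [smul_mul_assoc, map_smul] }
    (by
      refine LinearMap.ext fun x => ?_
      obtain ⟨d, rfl⟩ := ω.toGNS_surjective x
      change ω.toGNS (1 * d) = ω.toGNS d
      rw [one_mul])
    (fun a b => by
      refine LinearMap.ext fun x => ?_
      obtain ⟨d, rfl⟩ := ω.toGNS_surjective x
      change ω.toGNS (a * b * d) = ω.toGNS (a * (b * d))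
      rw [mul_assoc])

theorem rep_toGNS (ω : AlgState C) (c d : C) : ω.rep c (ω.toGNS d) = ω.toGNS (c * d) := rfl

/-- The representation `h_ω` on `H_ω⁰` of a grading `Γ` of `C` under which `ω` is invariant:
`h_ω [c] = [Γ c]`. -/
def gradingOp (ω : AlgState C) (Γ : Z2Grading C) (h : ∀ c, ω (Γ c) = ω c) :
    Module.End ℂ ω.GNS :=
  ω.nullSpace.mapQ ω.nullSpace Γ.lin (fun c hc => by
    change ω (star (Γ c) * Γ c) = 0
    rw [← Γ.commutes_star, ← map_mul, h]
    exact hc)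

theorem gradingOp_toGNS (ω : AlgState C) (Γ : Z2Grading C) (h : ∀ c, ω (Γ c) = ω c) (c : C) :
    ω.gradingOp Γ h (ω.toGNS c) = ω.toGNS (Γ c) := rfl

end AlgState

/-! ### Klein square roots -/

section Klein

variable {R : Type*} [Ring R] [Algebra ℂ R]

/-- `h^{1/2} = p₊ - i p₋`, where `p_± = (1 ± h)/2`, for an element `h` with `h² = 1`. -/
def halfPow (h : R) : R := (2⁻¹ : ℂ) • (1 + h) - Complex.I • (2⁻¹ : ℂ) • (1 - h)

/-- `h^{-1/2} = p₊ + i p₋`, where `p_± = (1 ± h)/2`, for an element `h` with `h² = 1`. -/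
def negHalfPow (h : R) : R := (2⁻¹ : ℂ) • (1 + h) + Complex.I • (2⁻¹ : ℂ) • (1 - h)

theorem halfPow_eq (h : R) :
    halfPow h = (2⁻¹ * (1 - Complex.I)) • (1 : R) + (2⁻¹ * (1 + Complex.I)) • h := by
  rw [halfPow]; module

theorem negHalfPow_eq (h : R) :
    negHalfPow h = (2⁻¹ * (1 + Complex.I)) • (1 : R) + (2⁻¹ * (1 - Complex.I)) • h := by
  rw [negHalfPow]; module

theorem halfPow_mul_negHalfPow {h : R} (hh : h * h = 1) : halfPow h * negHalfPow h = 1 := by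
  rw [halfPow_eq, negHalfPow_eq]
  simp only [add_mul, mul_add, smul_mul_smul_comm, one_mul, mul_one, hh]
  have hI : Complex.I ^ 2 = -1 := Complex.I_sq
  match_scalars
  · linear_combination (-1 / 2 : ℂ) * hI
  · linear_combination (1 / 2 : ℂ) * hI

theorem negHalfPow_mul_halfPow {h : R} (hh : h * h = 1) : negHalfPow h * halfPow h = 1 := by
  rw [halfPow_eq, negHalfPow_eq]
  simp only [add_mul, mul_add, smul_mul_smul_comm, one_mul, mul_one, hh]
  have hI : Complex.I ^ 2 = -1 := Complex.I_sq
  match_scalars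
  · linear_combination (-1 / 2 : ℂ) * hI
  · linear_combination (1 / 2 : ℂ) * hI

theorem halfPow_mul_halfPow {h : R} (hh : h * h = 1) : halfPow h * halfPow h = h := by
  rw [halfPow_eq]
  simp only [add_mul, mul_add, smul_mul_smul_comm, one_mul, mul_one, hh]
  have hI : Complex.I ^ 2 = -1 := Complex.I_sq
  match_scalars
  · linear_combination (1 / 2 : ℂ) * hI
  · linear_combination (-1 / 2 : ℂ) * hI

theorem star_halfPow [StarRing R] [StarModule ℂ R] {h : R} (hs : star h = h) :
    star (halfPow h) = negHalfPow h := by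
  rw [halfPow, negHalfPow]
  simp [star_sub, star_smul, hs]

theorem commute_halfPow (h : R) : h * halfPow h = halfPow h * h := by
  rw [halfPow_eq]
  simp [add_mul, mul_add]

theorem commute_negHalfPow (h : R) : h * negHalfPow h = negHalfPow h * h := by
  rw [negHalfPow_eq]
  simp [add_mul, mul_add]

/-- `η^{1/2} : t ↦ h^{1/2} t h^{-1/2}`. -/
def kleinConj (h : R) : R →ₗ[ℂ] R :=
  LinearMap.mulLeft ℂ (halfPow h) ∘ₗ LinearMap.mulRight ℂ (negHalfPow h)

/-- `η^{-1/2} : t ↦ h^{-1/2} t h^{1/2}`. -/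
def kleinConjInv (h : R) : R →ₗ[ℂ] R :=
  LinearMap.mulLeft ℂ (negHalfPow h) ∘ₗ LinearMap.mulRight ℂ (halfPow h)

theorem kleinConj_apply (h t : R) : kleinConj h t = halfPow h * (t * negHalfPow h) := rfl

theorem kleinConjInv_apply (h t : R) : kleinConjInv h t = negHalfPow h * (t * halfPow h) := rfl

end Klein

/-! ### Von Neumann algebras in standard form and their normal states -/

section VonNeumann

variable {G : Type*} [NormedAddCommGroup G] [InnerProductSpace ℂ G] [CompleteSpace G]

/-- The star-algebra of elements of a von Neumann algebra. -/
abbrev Elem (B : VonNeumannAlgebra G) : Type _ := B.toStarSubalgebra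

/-- The star-algebra of elements of the commutant. -/
abbrev CommElem (B : VonNeumannAlgebra G) : Type _ := B.commutant.toStarSubalgebra

/-- A state is faithful if `φ (a* a) = 0` only for `a = 0`. -/
def AlgState.IsFaithful {B : VonNeumannAlgebra G} (φ : AlgState (Elem B)) : Prop :=
  ∀ a, φ (star a * a) = 0 → a = 0

/-- A state is normal if it is `σ`-weakly continuous, that is, of the form
`a ↦ ∑ₙ ⟨xₙ, a yₙ⟩` with `∑ₙ ‖xₙ‖² < ∞` and `∑ₙ ‖yₙ‖² < ∞`. -/
def AlgState.IsNormal {B : VonNeumannAlgebra G} (φ : AlgState (Elem B)) : Prop :=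
  ∃ x y : ℕ → G, Summable (fun n => ‖x n‖ ^ 2) ∧ Summable (fun n => ‖y n‖ ^ 2) ∧
    ∀ a : Elem B, HasSum (fun n => inner ℂ (x n) ((a : G →L[ℂ] G) (y n))) (φ a)

/-- The set `𝓕₊(B)` of even faithful normal states on a graded von Neumann algebra, as a type. -/
structure EvenState {B : VonNeumannAlgebra G} (γ : Z2Grading (Elem B)) extends
    AlgState (Elem B) where
  faithful : toAlgState.IsFaithful
  normal : toAlgState.IsNormal
  even : ∀ a, toLin (γ a) = toLin a

/-- `x` is cyclic for `B` if `B x` is dense. -/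
def IsCyclicVector (B : VonNeumannAlgebra G) (x : G) : Prop :=
  DenseRange (fun a : Elem B => (a : G →L[ℂ] G) x)

/-- `x` is separating for `B` if `a x = 0` only for `a = 0`, for `a ∈ B`. -/
def IsSeparatingVector (B : VonNeumannAlgebra G) (x : G) : Prop :=
  ∀ a : Elem B, (a : G →L[ℂ] G) x = 0 → a = 0

/-- A standard form of the von Neumann algebra `B ⊆ B(G)`: a modular conjugation `J` and a closed
convex cone, fixed pointwise by `J`, in which every normal state has a unique vector
representative. -/
structure StandardForm (B : VonNeumannAlgebra G) where
  /-- the modular conjugation -/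
  J : G →L⋆[ℂ] G
  J_J : ∀ x, J (J x) = x
  /-- `J* = J` for the conjugate linear operator `J` -/
  J_adjoint : ∀ x y, inner ℂ (J x) y = inner ℂ (J y) x
  /-- `J B J = B'` -/
  J_conj : ∀ c : G →L[ℂ] G, c ∈ B.commutant ↔ ∃ b ∈ B, ∀ x, c x = J (b (J x))
  /-- the natural positive cone -/
  cone : Set G
  isClosed_cone : IsClosed cone
  zero_mem_cone : (0 : G) ∈ cone
  add_mem_cone : ∀ x ∈ cone, ∀ y ∈ cone, x + y ∈ cone
  smul_mem_cone : ∀ r : ℝ, 0 ≤ r → ∀ x ∈ cone, (r : ℂ) • x ∈ cone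
  J_cone : ∀ x ∈ cone, J x = x
  cyclic_iff_separating : ∀ x ∈ cone, IsCyclicVector B x ↔ IsSeparatingVector B x
  existsUnique_vector : ∀ φ : AlgState (Elem B), φ.IsNormal →
    ∃! x : G, x ∈ cone ∧ ∀ a : Elem B, φ a = inner ℂ x ((a : G →L[ℂ] G) x)

namespace StandardForm

variable {B : VonNeumannAlgebra G} (SF : StandardForm B) {γ : Z2Grading (Elem B)}
  (ν : EvenState γ)

/-- The vector `Λ_ν` in the natural positive cone with `ν(b) = ⟨Λ_ν, b Λ_ν⟩`. -/
def vector : G := (SF.existsUnique_vector ν.toAlgState ν.normal).choose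

theorem vector_mem_cone : SF.vector ν ∈ SF.cone :=
  (SF.existsUnique_vector ν.toAlgState ν.normal).choose_spec.1.1

theorem apply_eq_inner (a : Elem B) :
    ν.toAlgState a = inner ℂ (SF.vector ν) ((a : G →L[ℂ] G) (SF.vector ν)) :=
  (SF.existsUnique_vector ν.toAlgState ν.normal).choose_spec.1.2 a

theorem star_mul_apply (a b : Elem B) : ν.toAlgState (star a * b)
    = inner ℂ ((a : G →L[ℂ] G) (SF.vector ν)) ((b : G →L[ℂ] G) (SF.vector ν)) := by
  rw [apply_eq_inner SF]
  exact ContinuousLinearMap.adjoint_inner_right (a : G →L[ℂ] G) _ _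

theorem isSeparating : IsSeparatingVector B (SF.vector ν) := by
  intro a ha
  apply ν.faithful
  rw [SF.star_mul_apply, ha, inner_zero_left]

theorem isCyclic : IsCyclicVector B (SF.vector ν) :=
  (SF.cyclic_iff_separating _ (SF.vector_mem_cone ν)).2 (SF.isSeparating ν)

/-- The map `b ↦ b Λ_ν`. -/
def orbit : Elem B →ₗ[ℂ] G where
  toFun b := (b : G →L[ℂ] G) (SF.vector ν)
  map_add' _ _ := rfl
  map_smul' _ _ := rfl

theorem denseRange_orbit : DenseRange (SF.orbit ν) := SF.isCyclic ν

/-- The unitary representation `g_B` of the grading on the standard Hilbert space: the continuous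
extension of `b Λ_ν ↦ γ(b) Λ_ν`. -/
def gradingUnitary : G →L[ℂ] G := (SF.orbit ν ∘ₗ γ.lin).extendOfNorm (SF.orbit ν)

theorem inner_orbit (a b : Elem B) : inner ℂ (SF.orbit ν (γ a)) (SF.orbit ν (γ b))
    = inner ℂ (SF.orbit ν a) (SF.orbit ν b) := by
  change inner ℂ (((γ a : Elem B) : G →L[ℂ] G) (SF.vector ν)) _
    = inner ℂ ((a : G →L[ℂ] G) (SF.vector ν)) _
  change inner ℂ _ (((γ b : Elem B) : G →L[ℂ] G) (SF.vector ν))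
    = inner ℂ _ ((b : G →L[ℂ] G) (SF.vector ν))
  rw [← SF.star_mul_apply, ← SF.star_mul_apply, ← γ.commutes_star, ← map_mul]
  exact ν.even _

/-- `g_B b Λ_ν = γ(b) Λ_ν`. -/
theorem gradingUnitary_orbit (b : Elem B) :
    SF.gradingUnitary ν (SF.orbit ν b) = SF.orbit ν (γ b) := by
  refine LinearMap.extendOfNorm_eq (f := SF.orbit ν ∘ₗ γ.lin) (SF.denseRange_orbit ν)
    ⟨1, fun a => ?_⟩ b
  rw [one_mul]
  refine le_of_eq ?_
  change ‖SF.orbit ν (γ a)‖ = _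
  rw [norm_eq_sqrt_re_inner (𝕜 := ℂ), norm_eq_sqrt_re_inner (𝕜 := ℂ), inner_orbit]

/-- `g_B` is the only bounded operator with `g_B b Λ_ν = γ(b) Λ_ν` for all `b ∈ B`. -/
theorem gradingUnitary_unique (g : G →L[ℂ] G)
    (hg : ∀ b, g (SF.orbit ν b) = SF.orbit ν (γ b)) : g = SF.gradingUnitary ν := by
  refine ContinuousLinearMap.coeFn_injective ?_
  refine (SF.denseRange_orbit ν).equalizer g.continuous (SF.gradingUnitary ν).continuous ?_
  funext b
  simp [hg, gradingUnitary_orbit]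

/-- If one bounded operator `g` satisfies `g b Λ_φ = γ(b) Λ_φ` for all even faithful normal states
`φ` and all `b ∈ B`, then `g` is the unitary constructed from any one of these states. -/
theorem gradingUnitary_eq_of_forall (g : G →L[ℂ] G)
    (hg : ∀ φ : EvenState γ, ∀ b, g (SF.orbit φ b) = SF.orbit φ (γ b)) :
    SF.gradingUnitary ν = g :=
  (SF.gradingUnitary_unique ν g (hg ν)).symm

theorem gradingUnitary_mul_self : SF.gradingUnitary ν * SF.gradingUnitary ν = 1 := by
  refine ContinuousLinearMap.coeFn_injective ?_
  refine (SF.denseRange_orbit ν).equalizer (ContinuousLinearMap.continuous _)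
    (ContinuousLinearMap.continuous _) ?_
  funext b
  simp [gradingUnitary_orbit, γ.involutive]

theorem gradingUnitary_vector : SF.gradingUnitary ν (SF.vector ν) = SF.vector ν := by
  have h := SF.gradingUnitary_orbit ν 1
  rw [show γ (1 : Elem B) = 1 from map_one γ.toEquiv] at h
  exact h

theorem star_gradingUnitary : star (SF.gradingUnitary ν) = SF.gradingUnitary ν := by
  refine (ContinuousLinearMap.eq_adjoint_iff _ _).2 ?_ |>.symm
  intro x y
  refine (SF.denseRange_orbit ν).induction_on₂ (p := fun x y => inner ℂ (SF.gradingUnitary ν x) y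
    = inner ℂ x (SF.gradingUnitary ν y)) ?_ ?_ x y
  · exact isClosed_eq (by fun_prop) (by fun_prop)
  · intro a b
    rw [gradingUnitary_orbit, gradingUnitary_orbit, ← SF.inner_orbit ν a, γ.involutive]

/-- `g_B b g_B = γ(b)` for `b ∈ B`. -/
theorem gradingUnitary_conj (b : Elem B) :
    SF.gradingUnitary ν * (b : G →L[ℂ] G) * SF.gradingUnitary ν = (γ b : Elem B) := by
  refine ContinuousLinearMap.coeFn_injective ?_
  refine (SF.denseRange_orbit ν).equalizer (ContinuousLinearMap.continuous _)
    (ContinuousLinearMap.continuous _) ?_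
  funext c
  simp only [Function.comp_apply, mul_apply_eq_comp, gradingUnitary_orbit]
  have h : (b : G →L[ℂ] G) (SF.orbit ν (γ c)) = SF.orbit ν (b * γ c) := rfl
  rw [h, gradingUnitary_orbit, map_mul, γ.involutive]
  rfl

/-- The grading `a ↦ g_B a g_B` of `B(G)`. -/
def bigGrading : Z2Grading (G →L[ℂ] G) where
  toEquiv := Unitary.conjStarAlgAut ℂ (G →L[ℂ] G) ⟨SF.gradingUnitary ν, by
    rw [Unitary.mem_iff, star_gradingUnitary, gradingUnitary_mul_self]; exact ⟨rfl, rfl⟩⟩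
  involutive a := by
    rw [Unitary.conjStarAlgAut_apply, Unitary.conjStarAlgAut_apply]
    simp only [star_gradingUnitary]
    have h := SF.gradingUnitary_mul_self ν
    calc _ = (SF.gradingUnitary ν * SF.gradingUnitary ν) * a
          * (SF.gradingUnitary ν * SF.gradingUnitary ν) := by simp only [mul_assoc]
      _ = a := by rw [h, one_mul, mul_one]

theorem bigGrading_apply (a : G →L[ℂ] G) :
    SF.bigGrading ν a = SF.gradingUnitary ν * a * SF.gradingUnitary ν := by
  change SF.gradingUnitary ν * a * star (SF.gradingUnitary ν) = _
  rw [star_gradingUnitary]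

theorem bigGrading_mem_commutant (a : G →L[ℂ] G) (ha : a ∈ B.commutant.toStarSubalgebra) :
    SF.bigGrading ν a ∈ B.commutant.toStarSubalgebra := by
  change _ ∈ B.commutant
  replace ha : a ∈ B.commutant := ha
  rw [VonNeumannAlgebra.mem_commutant_iff] at ha ⊢
  intro b hb
  have h1 : SF.bigGrading ν (γ (⟨b, hb⟩ : Elem B) : Elem B) = b := by
    rw [bigGrading_apply, gradingUnitary_conj, γ.involutive]
  have h2 := ha (γ (⟨b, hb⟩ : Elem B) : Elem B) (γ (⟨b, hb⟩ : Elem B)).2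
  have h3 := congrArg (SF.bigGrading ν) h2
  rwa [map_mul, map_mul, h1] at h3

/-- The grading `γ_{B'}(b') = g_B b' g_B` of the commutant. -/
def commGrading : Z2Grading (CommElem B) :=
  (SF.bigGrading ν).restrict B.commutant.toStarSubalgebra (SF.bigGrading_mem_commutant ν)

/-- The unitary `g_B^{1/2} = p₊ - i p₋`. -/
def kleinUnitary : unitary (G →L[ℂ] G) :=
  ⟨halfPow (SF.gradingUnitary ν), by
    rw [Unitary.mem_iff, star_halfPow (SF.star_gradingUnitary ν)]
    exact ⟨negHalfPow_mul_halfPow (SF.gradingUnitary_mul_self ν),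
      halfPow_mul_negHalfPow (SF.gradingUnitary_mul_self ν)⟩⟩

/-- The twisted commutant `B^≀ = g_B^{1/2} B' g_B^{-1/2}`. -/
def twistedCommutant : StarSubalgebra ℂ (G →L[ℂ] G) :=
  B.commutant.toStarSubalgebra.map
    (StarAlgHomClass.toStarAlgHom (R := ℂ)
      (Unitary.conjStarAlgAut ℂ (G →L[ℂ] G) (SF.kleinUnitary ν)))

/-- The star-algebra of elements of the twisted commutant. -/
abbrev TwElem : Type _ := SF.twistedCommutant ν

theorem klein_apply (a : G →L[ℂ] G) :
    Unitary.conjStarAlgAut ℂ (G →L[ℂ] G) (SF.kleinUnitary ν) a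
      = halfPow (SF.gradingUnitary ν) * a * negHalfPow (SF.gradingUnitary ν) := by
  rw [Unitary.conjStarAlgAut_apply]
  change _ * _ * star (halfPow (SF.gradingUnitary ν)) = _
  rw [star_halfPow (SF.star_gradingUnitary ν)]
  rfl

/-- The Klein isomorphism `γ_B^{1/2} : B' → B^≀`, `b' ↦ g_B^{1/2} b' g_B^{-1/2}`. -/
def klein : CommElem B ≃⋆ₐ[ℂ] SF.TwElem ν where
  toFun b := ⟨Unitary.conjStarAlgAut ℂ (G →L[ℂ] G) (SF.kleinUnitary ν) b, ⟨b, b.2, rfl⟩⟩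
  invFun c := ⟨(Unitary.conjStarAlgAut ℂ (G →L[ℂ] G) (SF.kleinUnitary ν)).symm c, by
    obtain ⟨_, b, hb, rfl⟩ := c
    have h : (Unitary.conjStarAlgAut ℂ (G →L[ℂ] G) (SF.kleinUnitary ν)).symm
      (Unitary.conjStarAlgAut ℂ (G →L[ℂ] G) (SF.kleinUnitary ν) b) = b :=
        StarAlgEquiv.symm_apply_apply _ _
    exact h.symm ▸ hb⟩
  left_inv b := Subtype.ext (StarAlgEquiv.symm_apply_apply _ _)
  right_inv c := Subtype.ext (StarAlgEquiv.apply_symm_apply _ _)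
  map_mul' a b := Subtype.ext (map_mul _ (a : G →L[ℂ] G) b)
  map_add' a b := Subtype.ext (map_add _ (a : G →L[ℂ] G) b)
  map_star' a := Subtype.ext (map_star _ (a : G →L[ℂ] G))
  map_smul' r a := Subtype.ext (map_smul _ r (a : G →L[ℂ] G))

theorem klein_coe (b : CommElem B) : ((SF.klein ν b : SF.TwElem ν) : G →L[ℂ] G)
    = halfPow (SF.gradingUnitary ν) * b * negHalfPow (SF.gradingUnitary ν) :=
  SF.klein_apply ν b

theorem bigGrading_mem_twistedCommutant (a : G →L[ℂ] G) (ha : a ∈ SF.twistedCommutant ν) :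
    SF.bigGrading ν a ∈ SF.twistedCommutant ν := by
  obtain ⟨b, hb, rfl⟩ := ha
  refine ⟨SF.bigGrading ν b, SF.bigGrading_mem_commutant ν b hb, ?_⟩
  change Unitary.conjStarAlgAut ℂ (G →L[ℂ] G) (SF.kleinUnitary ν) (SF.bigGrading ν b)
    = SF.bigGrading ν (Unitary.conjStarAlgAut ℂ (G →L[ℂ] G) (SF.kleinUnitary ν) b)
  rw [klein_apply, klein_apply, bigGrading_apply, bigGrading_apply]
  have h1 := commute_halfPow (SF.gradingUnitary ν)
  have h2 := commute_negHalfPow (SF.gradingUnitary ν)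
  simp only [← mul_assoc]
  rw [h1]
  simp only [mul_assoc]
  rw [h2]

/-- The grading `γ_{B^≀}(b^≀) = g_B b^≀ g_B` of the twisted commutant. -/
def twGrading : Z2Grading (SF.TwElem ν) :=
  (SF.bigGrading ν).restrict (SF.twistedCommutant ν) (SF.bigGrading_mem_twistedCommutant ν)

theorem twGrading_coe (b : SF.TwElem ν) : ((SF.twGrading ν b : SF.TwElem ν) : G →L[ℂ] G)
    = SF.gradingUnitary ν * b * SF.gradingUnitary ν := SF.bigGrading_apply ν b

theorem commGrading_coe (b : CommElem B) : ((SF.commGrading ν b : CommElem B) : G →L[ℂ] G)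
    = SF.gradingUnitary ν * b * SF.gradingUnitary ν := SF.bigGrading_apply ν b

/-- The duality `⟨Λ_ν, b (g_B c g_B) Λ_ν⟩ = ⟨Λ_ν, γ(b) c Λ_ν⟩`: the gradings of `B'` and `B^≀` are
the dual `γ_B'` and the twisted dual `γ_B^≀` of the grading of `B`. -/
theorem inner_bigGrading (b : Elem B) (c : G →L[ℂ] G) :
    inner ℂ (SF.vector ν) (((b : G →L[ℂ] G) * SF.bigGrading ν c) (SF.vector ν))
      = inner ℂ (SF.vector ν) ((((γ b : Elem B) : G →L[ℂ] G) * c) (SF.vector ν)) := by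
  have h : ∀ x y, inner ℂ (SF.gradingUnitary ν x) y = inner ℂ x (SF.gradingUnitary ν y) := by
    intro x y
    have h1 := ContinuousLinearMap.adjoint_inner_left (SF.gradingUnitary ν) y x
    rwa [← ContinuousLinearMap.star_eq_adjoint, star_gradingUnitary] at h1
  rw [bigGrading_apply, ← gradingUnitary_conj]
  simp only [mul_apply_eq_comp]
  rw [gradingUnitary_vector, ← h, gradingUnitary_vector]

/-- The vector state `b ↦ ⟨Λ_ν, b Λ_ν⟩` on bounded operators; its restriction to `B'` is `ν'` and
its restriction to `B^≀` is `ν^≀`. -/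
def vectorState (b : G →L[ℂ] G) : ℂ := inner ℂ (SF.vector ν) (b (SF.vector ν))

end StandardForm

end VonNeumann

/-! ### Transport plans -/

section Plans

variable {H G : Type*} [NormedAddCommGroup H] [InnerProductSpace ℂ H] [CompleteSpace H]
  [NormedAddCommGroup G] [InnerProductSpace ℂ G] [CompleteSpace G]
  {A : VonNeumannAlgebra H} {B : VonNeumannAlgebra G}
  {α : Z2Grading (Elem A)} {β : Z2Grading (Elem B)}
  (SF : StandardForm B) (μ : EvenState α) (ν : EvenState β)

/-- The set `T^γ(μ, ν)` of graded transport plans from `μ` to `ν`: states on the usual algebraic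
tensor product `A ⊙ B'` with marginals `μ` and `ν'`, satisfying the balance condition for the
gradings. -/
def GradedPlans : Set (AlgState (Elem A ⊗[ℂ] CommElem B)) :=
  {ω | (∀ a, ω (a ⊗ₜ[ℂ] 1) = μ.toAlgState a) ∧
    (∀ b : CommElem B, ω (1 ⊗ₜ[ℂ] b) = SF.vectorState ν b) ∧
    ∀ a b, ω (α a ⊗ₜ[ℂ] b) = ω (a ⊗ₜ[ℂ] SF.commGrading ν b)}

/-- The set `T^F(μ, ν)` of fermionic transport plans from `μ` to `ν`: states on the algebraic Fermi
tensor product `A ⊠ B^≀` with marginals `μ` and `ν^≀`, satisfying the balance condition for the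
gradings. -/
def FermiPlans : Set (AlgState (Fermi α (SF.twGrading ν))) :=
  {ω | (∀ a, ω (Fermi.tmul _ _ a 1) = μ.toAlgState a) ∧
    (∀ b : SF.TwElem ν, ω (Fermi.tmul _ _ 1 b) = SF.vectorState ν b) ∧
    ∀ a b, ω (Fermi.tmul _ _ (α a) b) = ω (Fermi.tmul _ _ a (SF.twGrading ν b))}

variable {SF μ ν}

theorem GradedPlans.invariant (ω : GradedPlans SF μ ν) (c : Elem A ⊗[ℂ] CommElem B) :
    ω.1 (α.tensor (SF.commGrading ν) c) = ω.1 c := by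
  induction c with
  | zero => rw [map_zero]
  | tmul a b => rw [Z2Grading.tensor_tmul, ω.2.2.2, (SF.commGrading ν).involutive]
  | add x y hx hy => rw [map_add, map_add, map_add, hx, hy]

theorem FermiPlans.invariant (ω : FermiPlans SF μ ν) (c : Fermi α (SF.twGrading ν)) :
    ω.1 (α.fermi (SF.twGrading ν) c) = ω.1 c := by
  induction c using Fermi.induction with
  | h0 => rw [map_zero]
  | ht a b => rw [Z2Grading.fermi_tmul, ω.2.2.2, (SF.twGrading ν).involutive]
  | ha x y hx hy => rw [map_add, map_add, map_add, hx, hy]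

/-- The operator `h_ω` on `H_ω⁰` for a graded transport plan `ω`:
`h_ω [c] = [(γ_A ⊙ γ_{B'})(c)]`. -/
def GradedPlans.h (ω : GradedPlans SF μ ν) : Module.End ℂ ω.1.GNS :=
  ω.1.gradingOp (α.tensor (SF.commGrading ν)) (GradedPlans.invariant ω)

/-- The operator `h_ω` on `H_ω⁰` for a fermionic transport plan `ω`:
`h_ω [c] = [(γ_A ⊠ γ_{B^≀})(c)]`. -/
def FermiPlans.h (ω : FermiPlans SF μ ν) : Module.End ℂ ω.1.GNS :=
  ω.1.gradingOp (α.fermi (SF.twGrading ν)) (FermiPlans.invariant ω)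

/-- The representation `π_ω^F` of `A ⊠ B^≀` obtained from a graded transport plan `ω`:
`π_ω^F (a ⊠ b^≀) = π_ω(a ⊙ 1) η_ω^{1/2}(π_ω(1 ⊙ γ_B^{-1/2}(b^≀)))`, where
`η_ω^{1/2}(t) = h_ω^{1/2} t h_ω^{-1/2}`. -/
def GradedPlans.repF (ω : GradedPlans SF μ ν) :
    Fermi α (SF.twGrading ν) →ₗ[ℂ] Module.End ℂ ω.1.GNS :=
  LinearMap.mul' ℂ (Module.End ℂ ω.1.GNS)
    ∘ₗ TensorProduct.map
      (ω.1.rep.toLinearMap ∘ₗ (TensorProduct.mk ℂ (Elem A) (CommElem B)).flip 1)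
      (kleinConj (GradedPlans.h ω) ∘ₗ ω.1.rep.toLinearMap
        ∘ₗ TensorProduct.mk ℂ (Elem A) (CommElem B) 1
        ∘ₗ (SF.klein ν).symm.toAlgEquiv.toLinearMap)
    ∘ₗ (GradedTensorProduct.of ℂ α.part (SF.twGrading ν).part).symm.toLinearMap

theorem GradedPlans.repF_tmul (ω : GradedPlans SF μ ν) (a : Elem A) (b : SF.TwElem ν) :
    GradedPlans.repF ω (Fermi.tmul _ _ a b) = ω.1.rep (a ⊗ₜ[ℂ] 1)
      * kleinConj (GradedPlans.h ω) (ω.1.rep (1 ⊗ₜ[ℂ] (SF.klein ν).symm b)) := rfl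

/-- The representation `π_ω^⊙` of `A ⊙ B'` obtained from a fermionic transport plan `ω`:
`π_ω^⊙ (a ⊙ b') = π_ω(a ⊠ 1) η_ω^{-1/2}(π_ω(1 ⊠ γ_B^{1/2}(b')))`. -/
def FermiPlans.repU (ω : FermiPlans SF μ ν) :
    Elem A ⊗[ℂ] CommElem B →ₗ[ℂ] Module.End ℂ ω.1.GNS :=
  LinearMap.mul' ℂ (Module.End ℂ ω.1.GNS)
    ∘ₗ TensorProduct.map
      (ω.1.rep.toLinearMap
        ∘ₗ (GradedTensorProduct.of ℂ α.part (SF.twGrading ν).part).toLinearMap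
        ∘ₗ (TensorProduct.mk ℂ (Elem A) (SF.TwElem ν)).flip 1)
      (kleinConjInv (FermiPlans.h ω) ∘ₗ ω.1.rep.toLinearMap
        ∘ₗ (GradedTensorProduct.of ℂ α.part (SF.twGrading ν).part).toLinearMap
        ∘ₗ TensorProduct.mk ℂ (Elem A) (SF.TwElem ν) 1
        ∘ₗ (SF.klein ν).toAlgEquiv.toLinearMap)

theorem FermiPlans.repU_tmul (ω : FermiPlans SF μ ν) (a : Elem A) (b : CommElem B) :
    FermiPlans.repU ω (a ⊗ₜ[ℂ] b) = ω.1.rep (Fermi.tmul _ _ a 1)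
      * kleinConjInv (FermiPlans.h ω) (ω.1.rep (Fermi.tmul _ _ 1 (SF.klein ν b))) := rfl

/-- The functional `ω_F(c) = ⟨Ω, π_ω^F(c) Ω⟩` on `A ⊠ B^≀`. -/
def GradedPlans.toFermi (ω : GradedPlans SF μ ν) (c : Fermi α (SF.twGrading ν)) : ℂ :=
  inner ℂ ω.1.cyclicVector (GradedPlans.repF ω c ω.1.cyclicVector)

/-- The functional `ω_⊙(c) = ⟨Ω, π_ω^⊙(c) Ω⟩` on `A ⊙ B'`. -/
def FermiPlans.toUsual (ω : FermiPlans SF μ ν) (c : Elem A ⊗[ℂ] CommElem B) : ℂ :=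
  inner ℂ ω.1.cyclicVector (FermiPlans.repU ω c ω.1.cyclicVector)

end Plans

end

end FermiTransport

/-!
The vector `h_ω^{1/2} π_ω(1 ⊙ b) h_ω^{-1/2} Ω` can be computed explicitly: `Ω` is fixed by `h_ω`,
and on the classes `[1 ⊙ b]` the operator `h_ω^{1/2}` acts as `b ↦ δ^{1/2} b = b₊ - i b₋`, where
`δ` is the grading of the second factor. Hence `ω_F = ω ∘ T`, where `T` is the linear bijection
`a ⊠ κ(b) ↦ a ⊙ δ^{1/2} b` and `κ` is the Klein isomorphism, and in the same way `ω_⊙ = ω ∘ T⁻¹`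
(`FermiTransport.GradedPlans.toFermi_eq`, `FermiTransport.FermiPlans.toUsual_eq`). The two
constructions are therefore mutually inverse as soon as each of them preserves transport plans.

The marginals and the balance condition are immediate, because `ν'` is even and `g Λ_ν = Λ_ν`.
Positivity is the essential point. The map `T` is not multiplicative, but every linear functional
`φ` that is invariant under the product grading satisfies `φ (T (c* d)) = φ ((T c)* (T d))`
(`FermiTransport.Fermi.apply_untwist_star_mul`): on elementary tensors with a homogeneous second
entry, the signs in the product and involution of the Fermi tensor product amount to applying the
grading to the first factor, and invariance moves it to the second factor, where it compensates the
powers of `i` produced by `δ^{1/2}`. This one identity gives positivity in both directions.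
-/

open scoped TensorProduct ComplexOrder InnerProductSpace

namespace FermiTransport

noncomputable section

section Algebraic

variable {R S S' : Type*} [Ring R] [Algebra ℂ R] [StarRing R] [StarModule ℂ R]
  [Ring S] [Algebra ℂ S] [StarRing S] [StarModule ℂ S]
  [Ring S'] [Algebra ℂ S'] [StarRing S'] [StarModule ℂ S']

/-! ### Square roots of a grading -/

namespace Z2Grading

theorem lin_mul_lin (δ : Z2Grading S) : (δ.lin : Module.End ℂ S) * δ.lin = 1 :=
  LinearMap.ext δ.involutive

/-- The linear automorphism `δ^{1/2} : b ↦ b₊ - i b₋` of a graded algebra. It is a square root of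
the grading `δ` as a linear map, but it is not multiplicative. -/
def sqrt (δ : Z2Grading S) : S ≃ₗ[ℂ] S :=
  LinearEquiv.ofLinearMap (halfPow (δ.lin : Module.End ℂ S)) (negHalfPow (δ.lin : Module.End ℂ S))
    (halfPow_mul_negHalfPow δ.lin_mul_lin) (negHalfPow_mul_halfPow δ.lin_mul_lin)

theorem sqrt_of_mem_zero {δ : Z2Grading S} {b : S} (h : b ∈ δ.part 0) : δ.sqrt b = b := by
  change halfPow (δ.lin : Module.End ℂ S) b = b
  simp only [halfPow_eq, LinearMap.add_apply, LinearMap.smul_apply, Module.End.one_apply,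
    lin_apply, mem_part_zero.1 h]
  module

theorem sqrt_of_mem_one {δ : Z2Grading S} {b : S} (h : b ∈ δ.part 1) :
    δ.sqrt b = -(Complex.I • b) := by
  change halfPow (δ.lin : Module.End ℂ S) b = _
  simp only [halfPow_eq, LinearMap.add_apply, LinearMap.smul_apply, Module.End.one_apply,
    lin_apply, mem_part_one.1 h]
  module

theorem sqrt_one (δ : Z2Grading S) : δ.sqrt 1 = 1 :=
  sqrt_of_mem_zero (mem_part_zero.2 (map_one δ.toEquiv))

theorem sqrt_symm_one (δ : Z2Grading S) : δ.sqrt.symm 1 = 1 := by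
  rw [LinearEquiv.symm_apply_eq, sqrt_one]

theorem sqrt_apply (δ : Z2Grading S) (b : S) :
    δ.sqrt b = (2⁻¹ * (1 - Complex.I)) • b + (2⁻¹ * (1 + Complex.I)) • δ b := by
  change halfPow (δ.lin : Module.End ℂ S) b = _
  simp [halfPow_eq]

theorem sqrt_commutes (δ : Z2Grading S) (b : S) : δ.sqrt (δ b) = δ (δ.sqrt b) := by
  simp only [sqrt_apply, map_add, map_smul]

theorem sqrt_star_mul_of_mem_zero {δ : Z2Grading S} {b : S} (h : b ∈ δ.part 0) (c : S) :
    δ.sqrt (star b * c) = star (δ.sqrt b) * δ.sqrt c := by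
  have hb : δ (star b) = star b := by rw [δ.commutes_star, mem_part_zero.1 h]
  rw [sqrt_of_mem_zero h, sqrt_apply, sqrt_apply, map_mul, hb, mul_add (star b), mul_smul_comm,
    mul_smul_comm]

/-- For odd `b` the map `δ^{1/2}` fails to respect `(b, c) ↦ b* c`, exactly by a factor `δ`. -/
theorem grading_sqrt_star_mul_of_mem_one {δ : Z2Grading S} {b : S} (h : b ∈ δ.part 1) (c : S) :
    δ (δ.sqrt (star b * c)) = star (δ.sqrt b) * δ.sqrt c := by
  have hb : δ (star b) = -star b := by rw [δ.commutes_star, mem_part_one.1 h, star_neg]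
  rw [sqrt_of_mem_one h, sqrt_apply, sqrt_apply, map_mul, hb, map_add, map_smul, map_smul, map_mul,
    map_mul, map_neg, hb, δ.involutive, neg_neg, star_neg, star_smul, RCLike.star_def,
    Complex.conj_I, neg_smul, neg_neg, mul_add (_ • star b), mul_smul_comm, mul_smul_comm, smul_mul_assoc,
    smul_mul_assoc, neg_mul]
  have hI : Complex.I ^ 2 = -1 := Complex.I_sq
  match_scalars
  · linear_combination (-1 / 2 : ℂ) * hI
  · linear_combination (1 / 2 : ℂ) * hI

end Z2Grading

namespace AlgState

variable (ω : AlgState R) (Γ : Z2Grading R) (h : ∀ c, ω (Γ c) = ω c)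

theorem halfPow_gradingOp_toGNS (c : R) :
    halfPow (ω.gradingOp Γ h) (ω.toGNS c) = ω.toGNS (Γ.sqrt c) := by
  rw [halfPow_eq, Γ.sqrt_apply, map_add, map_smul, map_smul]
  rfl

theorem negHalfPow_gradingOp_toGNS (c : R) :
    negHalfPow (ω.gradingOp Γ h) (ω.toGNS c) = ω.toGNS (Γ.sqrt.symm c) := by
  obtain ⟨d, rfl⟩ := Γ.sqrt.surjective c
  have hh : ω.gradingOp Γ h * ω.gradingOp Γ h = 1 := by
    refine LinearMap.ext fun x => ?_
    obtain ⟨d, rfl⟩ := ω.toGNS_surjective x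
    exact congrArg ω.toGNS (Γ.involutive d)
  rw [LinearEquiv.symm_apply_apply, ← halfPow_gradingOp_toGNS ω Γ h, ← Module.End.mul_apply,
    negHalfPow_mul_halfPow hh, Module.End.one_apply]

theorem kleinConj_rep_cyclicVector (c : R) :
    kleinConj (ω.gradingOp Γ h) (ω.rep c) ω.cyclicVector = ω.toGNS (Γ.sqrt c) := by
  rw [kleinConj_apply, Module.End.mul_apply, Module.End.mul_apply, cyclicVector,
    negHalfPow_gradingOp_toGNS, Z2Grading.sqrt_symm_one, rep_toGNS, mul_one, halfPow_gradingOp_toGNS]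

theorem kleinConjInv_rep_cyclicVector (c : R) :
    kleinConjInv (ω.gradingOp Γ h) (ω.rep c) ω.cyclicVector = ω.toGNS (Γ.sqrt.symm c) := by
  rw [kleinConjInv_apply, Module.End.mul_apply, Module.End.mul_apply, cyclicVector,
    halfPow_gradingOp_toGNS, Γ.sqrt_one, rep_toGNS, mul_one, negHalfPow_gradingOp_toGNS]

theorem inner_cyclicVector_toGNS (c : R) : inner ℂ ω.cyclicVector (ω.toGNS c) = ω c := by
  rw [cyclicVector, inner_toGNS, star_one, one_mul]

end AlgState

/-! ### The untwisting map between the two tensor products -/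

namespace Z2Grading

theorem tensor_sqrt_one_tmul (γ : Z2Grading R) (δ : Z2Grading S) (b : S) :
    (γ.tensor δ).sqrt (1 ⊗ₜ[ℂ] b) = 1 ⊗ₜ[ℂ] δ.sqrt b := by
  rw [sqrt_apply, sqrt_apply, tensor_tmul, map_one, TensorProduct.tmul_add,
    TensorProduct.tmul_smul, TensorProduct.tmul_smul]

theorem fermi_sqrt_one_tmul (γ : Z2Grading R) (δ : Z2Grading S) (b : S) :
    (γ.fermi δ).sqrt (Fermi.tmul γ δ 1 b) = Fermi.tmul γ δ 1 (δ.sqrt b) := by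
  rw [sqrt_apply, sqrt_apply, fermi_tmul, map_one, Fermi.tmul_add, Fermi.tmul, Fermi.tmul,
    Fermi.tmul, Fermi.tmul, TensorProduct.tmul_smul, TensorProduct.tmul_smul, map_smul, map_smul]

theorem fermi_sqrt_symm_one_tmul (γ : Z2Grading R) (δ : Z2Grading S) (b : S) :
    (γ.fermi δ).sqrt.symm (Fermi.tmul γ δ 1 b) = Fermi.tmul γ δ 1 (δ.sqrt.symm b) := by
  rw [LinearEquiv.symm_apply_eq, fermi_sqrt_one_tmul, LinearEquiv.apply_symm_apply]

theorem map_sqrt {δ : Z2Grading S} {δ' : Z2Grading S'} (κ : S ≃⋆ₐ[ℂ] S')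
    (hκ : ∀ b, κ (δ b) = δ' (κ b)) (b : S) : κ (δ.sqrt b) = δ'.sqrt (κ b) := by
  rw [sqrt_apply, sqrt_apply, map_add, map_smul, map_smul, hκ]

theorem map_mem_part {δ : Z2Grading S} {δ' : Z2Grading S'} (κ : S ≃⋆ₐ[ℂ] S')
    (hκ : ∀ b, κ (δ b) = δ' (κ b)) {i : ZMod 2} {b : S'} (h : b ∈ δ'.part i) :
    κ.symm b ∈ δ.part i := by
  have h' : κ (δ (κ.symm b)) = κ ((-1 : ℤˣ) ^ i • κ.symm b) := by
    rw [hκ, StarAlgEquiv.apply_symm_apply, mem_part.1 h, Units.smul_def, Units.smul_def,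
      map_zsmul, StarAlgEquiv.apply_symm_apply]
  exact κ.injective h'

end Z2Grading

namespace AlgState

theorem inner_rep_mul_kleinConj (ω : AlgState (R ⊗[ℂ] S)) (γ : Z2Grading R) (δ : Z2Grading S)
    (h : ∀ c, ω (γ.tensor δ c) = ω c) (a : R) (b : S) :
    inner ℂ ω.cyclicVector ((ω.rep (a ⊗ₜ[ℂ] 1)
      * kleinConj (ω.gradingOp (γ.tensor δ) h) (ω.rep (1 ⊗ₜ[ℂ] b))) ω.cyclicVector)
      = ω (a ⊗ₜ[ℂ] δ.sqrt b) := by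
  rw [Module.End.mul_apply, kleinConj_rep_cyclicVector, Z2Grading.tensor_sqrt_one_tmul, rep_toGNS,
    inner_cyclicVector_toGNS, Algebra.TensorProduct.tmul_mul_tmul, mul_one, one_mul]

theorem inner_rep_mul_kleinConjInv (γ : Z2Grading R) (δ : Z2Grading S) (ω : AlgState (Fermi γ δ))
    (h : ∀ c, ω (γ.fermi δ c) = ω c) (a : R) (b : S) :
    inner ℂ ω.cyclicVector ((ω.rep (Fermi.tmul γ δ a 1)
      * kleinConjInv (ω.gradingOp (γ.fermi δ) h) (ω.rep (Fermi.tmul γ δ 1 b))) ω.cyclicVector)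
      = ω (Fermi.tmul γ δ a (δ.sqrt.symm b)) := by
  have h1 : (1 : S) ∈ δ.part 0 := Z2Grading.mem_part_zero.2 (_root_.map_one δ.toEquiv)
  rw [Module.End.mul_apply, kleinConjInv_rep_cyclicVector, Z2Grading.fermi_sqrt_symm_one_tmul,
    rep_toGNS, inner_cyclicVector_toGNS, Fermi.tmul_mul_tmul, Z2Grading.even_of_mem_zero h1,
    Z2Grading.odd_of_mem_zero h1, mul_one, one_mul, zero_mul, Fermi.tmul_zero, add_zero]

end AlgState

namespace Fermi

variable (γ : Z2Grading R) (δ : Z2Grading S) (δ' : Z2Grading S') (κ : S ≃⋆ₐ[ℂ] S')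

/-- The linear bijection `a ⊠ κ(b) ↦ a ⊗ δ^{1/2} b` from the Fermi tensor product to the usual
tensor product, for an isomorphism `κ` of the second factors. It carries transport plans to
transport plans by precomposition, although it is not an algebra homomorphism. -/
def untwist : Fermi γ δ' ≃ₗ[ℂ] R ⊗[ℂ] S :=
  (GradedTensorProduct.of ℂ γ.part δ'.part).symm ≪≫ₗ
    TensorProduct.congr (LinearEquiv.refl ℂ R) (κ.symm.toAlgEquiv.toLinearEquiv ≪≫ₗ δ.sqrt)

theorem untwist_tmul (a : R) (b : S') :
    untwist γ δ δ' κ (tmul γ δ' a b) = a ⊗ₜ[ℂ] δ.sqrt (κ.symm b) := rfl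

theorem untwist_symm_tmul (a : R) (b : S) :
    (untwist γ δ δ' κ).symm (a ⊗ₜ[ℂ] b) = tmul γ δ' a (κ (δ.sqrt.symm b)) := by
  rw [LinearEquiv.symm_apply_eq, untwist_tmul, StarAlgEquiv.symm_apply_apply,
    LinearEquiv.apply_symm_apply]

variable {γ δ δ' κ}

theorem star_tmul_mul_tmul_of_mem_zero {a a' : R} {b b' : S} (hb : b ∈ δ.part 0) :
    star (tmul γ δ a b) * tmul γ δ a' b' = tmul γ δ (star a * a') (star b * b') := by
  have hs := star_mem_part hb
  rw [star_tmul, Z2Grading.even_of_mem_zero hb, Z2Grading.odd_of_mem_zero hb, star_zero,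
    tmul_zero, add_zero, tmul_mul_tmul, Z2Grading.even_of_mem_zero hs,
    Z2Grading.odd_of_mem_zero hs, zero_mul, tmul_zero, add_zero]

theorem star_tmul_mul_tmul_of_mem_one {a a' : R} {b b' : S} (hb : b ∈ δ.part 1) :
    star (tmul γ δ a b) * tmul γ δ a' b' = tmul γ δ (γ (star a * a')) (star b * b') := by
  have hs := star_mem_part hb
  rw [star_tmul, Z2Grading.even_of_mem_one hb, Z2Grading.odd_of_mem_one hb, star_zero,
    tmul_zero, zero_add, tmul_mul_tmul, Z2Grading.even_of_mem_one hs,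
    Z2Grading.odd_of_mem_one hs, zero_mul, tmul_zero, zero_add, map_mul, γ.commutes_star]

/-- A functional that is invariant under the product grading does not notice that the untwisting
map fails to be a star-homomorphism, as far as the forms `(c, d) ↦ c* d` are concerned. -/
theorem apply_untwist_star_mul (hκ : ∀ b, κ (δ b) = δ' (κ b)) (φ : R ⊗[ℂ] S →ₗ[ℂ] ℂ)
    (hφ : ∀ a b, φ (γ a ⊗ₜ[ℂ] b) = φ (a ⊗ₜ[ℂ] δ b)) (c d : Fermi γ δ') :
    φ (untwist γ δ δ' κ (star c * d))
      = φ (star (untwist γ δ δ' κ c) * untwist γ δ δ' κ d) := by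
  have key : ∀ i a a' b b', b ∈ δ'.part i →
      φ (untwist γ δ δ' κ (star (tmul γ δ' a b) * tmul γ δ' a' b'))
        = φ (star (untwist γ δ δ' κ (tmul γ δ' a b)) * untwist γ δ δ' κ (tmul γ δ' a' b')) := by
    intro i a a' b b' hb
    have hi : ∀ i : ZMod 2, i = 0 ∨ i = 1 := by decide
    have hb' := Z2Grading.map_mem_part κ hκ hb
    simp only [untwist_tmul, TensorProduct.star_tmul, Algebra.TensorProduct.tmul_mul_tmul]
    obtain rfl | rfl := hi i
    · rw [star_tmul_mul_tmul_of_mem_zero hb, untwist_tmul, map_mul, map_star,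
        Z2Grading.sqrt_star_mul_of_mem_zero hb']
    · rw [star_tmul_mul_tmul_of_mem_one hb, untwist_tmul, hφ, map_mul, map_star,
        Z2Grading.grading_sqrt_star_mul_of_mem_one hb']
  induction c using induction_homogeneous with
  | h0 => simp
  | ha x y hx hy => simp only [star_add, add_mul, map_add, hx, hy]
  | ht i j a b ha hb =>
    induction d using induction with
    | h0 => simp
    | ha x y hx hy => simp only [mul_add, map_add, hx, hy]
    | ht a' b' => exact key j a a' b b' hb

end Fermi

end Algebraic

/-! ### Klein isomorphism and vector state -/

section Transport

variable {H G : Type*} [NormedAddCommGroup H] [InnerProductSpace ℂ H] [CompleteSpace H]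
  [NormedAddCommGroup G] [InnerProductSpace ℂ G] [CompleteSpace G]
  {A : VonNeumannAlgebra H} {B : VonNeumannAlgebra G}
  {α : Z2Grading (Elem A)} {β : Z2Grading (Elem B)}

namespace StandardForm

variable (SF : StandardForm B) (ν : EvenState β)

theorem klein_commGrading (b : CommElem B) :
    SF.klein ν (SF.commGrading ν b) = SF.twGrading ν (SF.klein ν b) := by
  refine Subtype.ext ?_
  rw [klein_coe, commGrading_coe, twGrading_coe, klein_coe]
  have h1 := commute_halfPow (SF.gradingUnitary ν)
  have h2 := commute_negHalfPow (SF.gradingUnitary ν)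
  simp only [← mul_assoc]
  rw [h1]
  simp only [mul_assoc]
  rw [h2]

theorem inner_gradingUnitary (x y : G) :
    inner ℂ (SF.gradingUnitary ν x) y = inner ℂ x (SF.gradingUnitary ν y) := by
  have h := ContinuousLinearMap.adjoint_inner_left (SF.gradingUnitary ν) y x
  rwa [← ContinuousLinearMap.star_eq_adjoint, star_gradingUnitary] at h

theorem negHalfPow_gradingUnitary_vector :
    negHalfPow (SF.gradingUnitary ν) (SF.vector ν) = SF.vector ν := by
  rw [negHalfPow_eq]
  simp only [_root_.add_apply, _root_.smul_apply,
    one_apply_eq_self, gradingUnitary_vector]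
  module

theorem vectorState_klein (b : CommElem B) :
    SF.vectorState ν (SF.klein ν b) = SF.vectorState ν b := by
  have h := ContinuousLinearMap.adjoint_inner_left (halfPow (SF.gradingUnitary ν))
    ((b : G →L[ℂ] G) (SF.vector ν)) (SF.vector ν)
  rw [← ContinuousLinearMap.star_eq_adjoint, star_halfPow (SF.star_gradingUnitary ν),
    negHalfPow_gradingUnitary_vector] at h
  rw [vectorState, klein_coe, vectorState, h]
  simp only [mul_apply_eq_comp, negHalfPow_gradingUnitary_vector]

theorem vectorState_commGrading (b : CommElem B) :
    SF.vectorState ν (SF.commGrading ν b) = SF.vectorState ν b := by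
  rw [vectorState, commGrading_coe, vectorState]
  simp only [mul_apply_eq_comp, gradingUnitary_vector]
  rw [← inner_gradingUnitary, gradingUnitary_vector]

theorem vectorState_sqrt (b : CommElem B) :
    SF.vectorState ν ((SF.commGrading ν).sqrt b : CommElem B) = SF.vectorState ν b := by
  have h := SF.vectorState_commGrading ν b
  rw [Z2Grading.sqrt_apply]
  rw [vectorState, vectorState] at h
  change inner ℂ (SF.vector ν) ((2⁻¹ * (1 - Complex.I)) • (b : G →L[ℂ] G) (SF.vector ν)
    + (2⁻¹ * (1 + Complex.I)) • ((SF.commGrading ν b : CommElem B) : G →L[ℂ] G) (SF.vector ν)) = _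
  rw [inner_add_right, inner_smul_right, inner_smul_right, h, vectorState]
  ring

/-- The untwisting map from `A ⊠ B^≀` to `A ⊙ B'` along the Klein isomorphism. -/
abbrev untwist (α : Z2Grading (Elem A)) :
    Fermi α (SF.twGrading ν) ≃ₗ[ℂ] Elem A ⊗[ℂ] CommElem B :=
  Fermi.untwist α (SF.commGrading ν) (SF.twGrading ν) (SF.klein ν)

theorem untwist_tmul_one (a : Elem A) :
    SF.untwist ν α (Fermi.tmul _ _ a 1) = a ⊗ₜ[ℂ] 1 := by
  rw [Fermi.untwist_tmul, map_one, Z2Grading.sqrt_one]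

theorem untwist_symm_tmul_one (a : Elem A) :
    (SF.untwist ν α).symm (a ⊗ₜ[ℂ] 1) = Fermi.tmul _ _ a 1 := by
  rw [LinearEquiv.symm_apply_eq, untwist_tmul_one]

end StandardForm

/-! ### The transformed functionals and the bijection -/

variable {SF : StandardForm B} {μ : EvenState α} {ν : EvenState β}

theorem GradedPlans.toFermi_eq (ω : GradedPlans SF μ ν) (c : Fermi α (SF.twGrading ν)) :
    GradedPlans.toFermi ω c = ω.1 (SF.untwist ν α c) := by
  rw [GradedPlans.toFermi]
  induction c using Fermi.induction with
  | h0 => simp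
  | ha x y hx hy => simp only [map_add, LinearMap.add_apply, inner_add_right, hx, hy]
  | ht a b =>
    exact AlgState.inner_rep_mul_kleinConj ω.1 α (SF.commGrading ν) (GradedPlans.invariant ω) a
      ((SF.klein ν).symm b)

theorem FermiPlans.toUsual_eq (ω : FermiPlans SF μ ν) (c : Elem A ⊗[ℂ] CommElem B) :
    FermiPlans.toUsual ω c = ω.1 ((SF.untwist ν α).symm c) := by
  rw [FermiPlans.toUsual]
  induction c with
  | zero => simp
  | add x y hx hy => simp only [map_add, LinearMap.add_apply, inner_add_right, hx, hy]
  | tmul a b =>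
    have h : (SF.twGrading ν).sqrt.symm (SF.klein ν b)
        = SF.klein ν ((SF.commGrading ν).sqrt.symm b) := by
      rw [LinearEquiv.symm_apply_eq, ← Z2Grading.map_sqrt (SF.klein ν) (SF.klein_commGrading ν),
        LinearEquiv.apply_symm_apply]
    rw [Fermi.untwist_symm_tmul, ← h]
    exact AlgState.inner_rep_mul_kleinConjInv α (SF.twGrading ν) ω.1 (FermiPlans.invariant ω) a
      (SF.klein ν b)

/-- The fermionic transport plan `ω ∘ T` of a graded transport plan `ω`, with `T` the untwisting
map. -/
def GradedPlans.toFermiPlan (ω : GradedPlans SF μ ν) : FermiPlans SF μ ν :=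
  ⟨{ toLin := ω.1.toLin ∘ₗ (SF.untwist ν α).toLinearMap
     map_one := by
      change ω.1 (SF.untwist ν α 1) = 1
      rw [Fermi.one_def, SF.untwist_tmul_one]
      exact ω.1.map_one
     nonneg := fun c => by
      change 0 ≤ ω.1 (SF.untwist ν α (star c * c))
      rw [Fermi.apply_untwist_star_mul (SF.klein_commGrading ν) ω.1.toLin ω.2.2.2]
      exact ω.1.nonneg _ },
    fun a => by
      change ω.1 (SF.untwist ν α _) = _
      rw [SF.untwist_tmul_one, ω.2.1],
    fun b => by
      change ω.1 (SF.untwist ν α _) = _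
      rw [Fermi.untwist_tmul, ω.2.2.1, SF.vectorState_sqrt, ← SF.vectorState_klein,
        StarAlgEquiv.apply_symm_apply],
    fun a b => by
      change ω.1 (SF.untwist ν α _) = ω.1 (SF.untwist ν α _)
      obtain ⟨b, rfl⟩ : ∃ b', SF.klein ν b' = b := ⟨_, StarAlgEquiv.apply_symm_apply _ b⟩
      rw [Fermi.untwist_tmul, Fermi.untwist_tmul, ω.2.2.2, ← SF.klein_commGrading,
        StarAlgEquiv.symm_apply_apply, StarAlgEquiv.symm_apply_apply, Z2Grading.sqrt_commutes]⟩

theorem FermiPlans.balance_untwist_symm (ω : FermiPlans SF μ ν) (a : Elem A) (b : CommElem B) :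
    ω.1 ((SF.untwist ν α).symm (α a ⊗ₜ[ℂ] b))
      = ω.1 ((SF.untwist ν α).symm (a ⊗ₜ[ℂ] SF.commGrading ν b)) := by
  obtain ⟨b, rfl⟩ := (SF.commGrading ν).sqrt.surjective b
  rw [← Z2Grading.sqrt_commutes, Fermi.untwist_symm_tmul, Fermi.untwist_symm_tmul,
    LinearEquiv.symm_apply_apply, LinearEquiv.symm_apply_apply, ω.2.2.2, SF.klein_commGrading]

/-- The graded transport plan `ω ∘ T⁻¹` of a fermionic transport plan `ω`, with `T` the untwisting
map. -/
def FermiPlans.toGradedPlan (ω : FermiPlans SF μ ν) : GradedPlans SF μ ν :=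
  ⟨{ toLin := ω.1.toLin ∘ₗ (SF.untwist ν α).symm.toLinearMap
     map_one := by
      change ω.1 ((SF.untwist ν α).symm 1) = 1
      rw [Algebra.TensorProduct.one_def, SF.untwist_symm_tmul_one]
      exact ω.1.map_one
     nonneg := fun c => by
      change 0 ≤ ω.1 ((SF.untwist ν α).symm (star c * c))
      obtain ⟨d, rfl⟩ := (SF.untwist ν α).surjective c
      -- The identity is applied to `ω ∘ T⁻¹`, which is invariant but not yet known to be positive.
      have h := Fermi.apply_untwist_star_mul (SF.klein_commGrading ν)
        (ω.1.toLin ∘ₗ (SF.untwist ν α).symm.toLinearMap) (FermiPlans.balance_untwist_symm ω) d d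
      simp only [LinearMap.comp_apply, LinearEquiv.coe_coe, LinearEquiv.symm_apply_apply] at h
      rw [← h]
      exact ω.1.nonneg d },
    fun a => by
      change ω.1 ((SF.untwist ν α).symm _) = _
      rw [SF.untwist_symm_tmul_one, ω.2.1],
    fun b => by
      change ω.1 ((SF.untwist ν α).symm _) = _
      obtain ⟨b, rfl⟩ := (SF.commGrading ν).sqrt.surjective b
      rw [Fermi.untwist_symm_tmul, ω.2.2.1, LinearEquiv.symm_apply_apply, SF.vectorState_klein,
        SF.vectorState_sqrt],
    FermiPlans.balance_untwist_symm ω⟩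

theorem AlgState.ext_apply {C : Type*} [Ring C] [Algebra ℂ C] [StarRing C] {φ ψ : AlgState C}
    (h : ∀ c, φ c = ψ c) : φ = ψ := by
  obtain ⟨φ, _, _⟩ := φ
  obtain ⟨ψ, _, _⟩ := ψ
  obtain rfl : φ = ψ := LinearMap.ext h
  rfl

/-- The bijection `ω ↦ ω ∘ T` from graded to fermionic transport plans. -/
def plansEquiv : GradedPlans SF μ ν ≃ FermiPlans SF μ ν where
  toFun := GradedPlans.toFermiPlan
  invFun := FermiPlans.toGradedPlan
  left_inv ω := Subtype.ext <| AlgState.ext_apply fun c =>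
    congrArg ω.1 ((SF.untwist ν α).apply_symm_apply c)
  right_inv ω := Subtype.ext <| AlgState.ext_apply fun c =>
    congrArg ω.1 ((SF.untwist ν α).symm_apply_apply c)

end Transport

end

end FermiTransport

theorem theorem5p8 {H G : Type*}
    [NormedAddCommGroup H] [InnerProductSpace ℂ H] [CompleteSpace H]
    [NormedAddCommGroup G] [InnerProductSpace ℂ G] [CompleteSpace G]
    (A : VonNeumannAlgebra H) (B : VonNeumannAlgebra G)
    (γA : FermiTransport.Z2Grading (FermiTransport.Elem A))
    (γB : FermiTransport.Z2Grading (FermiTransport.Elem B))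
    (SF : FermiTransport.StandardForm B)
    (μ : FermiTransport.EvenState γA) (ν : FermiTransport.EvenState γB) :
    ∃ f : FermiTransport.GradedPlans SF μ ν ≃ FermiTransport.FermiPlans SF μ ν,
      (∀ ω c, (f ω).1 c = FermiTransport.GradedPlans.toFermi ω c) ∧
      (∀ ω c, (f.symm ω).1 c = FermiTransport.FermiPlans.toUsual ω c) := by
  exact ⟨FermiTransport.plansEquiv, fun ω c => (FermiTransport.GradedPlans.toFermi_eq ω c).symm,
    fun ω c => (FermiTransport.FermiPlans.toUsual_eq ω c).symm⟩
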